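/- Let $k_1,k_2,\dots$ be nonnegative integers with $k_i>0$ for infinitely many $i$. Let $\Lambda$ be the small category with objects $v_1,v_2,\dots$ generated by edges $\alpha_i,\beta_i,\gamma_i^{(1)},\dots,\gamma_i^{(k_i)}$, $i\ge 1$, each with source $v_{i+1}$ and range $v_i$, subject only to the relations $\alpha_i\beta_{i+1}=\beta_i\alpha_{i+1}$ (composition $\mu\nu$ is defined when the source $s(\mu)$ equals the range $r(\nu)$; subscripts are dropped when they are clear; $|\mu|$ is the number of edges of $\mu$). Let $\Lambda^*$ be the set of nonempty directed hereditary subsets of $\Lambda$ (with respect to the prefix order), $Z(\mu)=\{x\in\Lambda^*:\mu\in x\}$, and give $\Lambda^*$ the topology with base the sets $Z(\lambda)\setminus\bigcup_{j=1}^t Z(\mu_j)$. Let $\partial\Lambda$ be the closure of the set of maximal elements of $\Lambda^*$, and $X=\partial\Lambda\cap Z(v_1)$. Let $G(\Lambda)$ be the étale groupoid of classes $[\mu,\nu,x]$, where $\mu,\nu\in\Lambda$, $x\in\Lambda^*$, $s(\mu)=s(\nu)=r(x)$, for the equivalence relation generated by $(\mu,\nu,\eta x)\sim(\mu\eta,\nu\eta,x)$,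 with $r[\mu,\nu,x]=\mu x$, $s[\mu,\nu,x]=\nu x$, $[\mu,\nu,x][\nu,\eta,x]=[\mu,\eta,x]$, $[\mu,\nu,x]^{-1}=[\nu,\mu,x]$, and topology with base the sets $[\mu,\nu,E]=\{[\mu,\nu,x]:x\in E,\ r(x)=s(\mu)=s(\nu)\}$, $E$ compact open. Let $G=G(\Lambda)|_X$ be its restriction to $X$, with $C^*(G)$ its full groupoid $C^*$-algebra; below, $[\mu,\nu,E]$ denotes the intersection of this set with $G$. For $i\ge 0$ let $E_i$ be the set of $\mu\in\Lambda$ with $r(\mu)=v_1$ and $|\mu|=i$; let $\Phi_i$ consist of $v_1$ and of all $\lambda\in\Lambda$ with $r(\lambda)=v_1$ and $|\lambda|\le i$ that end in an edge $\gamma_n^{(j)}$; and let $F_i=\{\eta\beta^q:\eta\in\Phi_i,\ |\eta|+q=i+1\}$. Then the sets $[\nu,\mu,Z(\beta_{i+1})^c]$ ($\mu,\nu\in E_i$), $[\eta,\xi,Z(v_{i+2})]$ ($\xi,\eta\in F_i$) and $[\alpha_1,\beta_1,Z(v_2)]$ are compact open subsets of $G$. Let $C_i\subseteq C^*(G)$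 be the $*$-subalgebra generated by the characteristic functions \[ \chi_{[\nu,\mu,Z(\beta_{i+1})^c]}\ (\mu,\nu\in E_i),\qquad \chi_{[\eta,\xi,Z(v_{i+2})]}\ (\xi,\eta\in F_i). \] Each $C_i$ is finite dimensional and is the linear span of these generators, $C_0\subseteq C_1\subseteq\cdots$, and the closed $*$-subalgebra $C$ generated by all the $C_i$ is $\overline{\bigcup_i C_i}$, an AF algebra. The AF subalgebra $C$ is a proper subalgebra of $C^*(G)$: for every $i$ and each of the above generators $\chi_S$ of $C_i$ one has $\|\chi_{[\alpha_1,\beta_1,Z(v_2)]}-\chi_S\|\ge 1$, and $\chi_{[\alpha_1,\beta_1,Z(v_2)]}\in C^*(G)\setminus C$; in particular $C\ne C^*(G)$. -/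

import Mathlib

open scoped ENNReal CompactlySupported

noncomputable section

namespace PathAmalgam

/-! ## The category of paths

The vertices `v₁, v₂, …` are numbered `0, 1, …`, and `k n` is the number of edges `γ` from the
vertex number `n + 1` to the vertex number `n`, so `k n` stands for `kₙ₊₁`.  At each vertex `n` there
are moreover one edge `α` and one edge `β` from `n + 1` to `n`; the only relations are `αβ = βα`.
-/

/-- Words in normal form: `flat p q` is `α^p β^q` and `cut p q j w` is `α^p β^q γ^{(j)} w`.
Every product of edges `α`, `β`, `γ^{(j)}` can be written in exactly one way like this, because
`α`, `β` commute and there are no other relations. -/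
inductive NWord : Type
  | flat (p q : ℕ) : NWord
  | cut (p q j : ℕ) (w : NWord) : NWord

namespace NWord

/-- Concatenation of words, brought to normal form by `αβ = βα`. -/
def mul : NWord → NWord → NWord
  | flat p q, flat p' q' => flat (p + p') (q + q')
  | flat p q, cut p' q' j w => cut (p + p') (q + q') j w
  | cut p q j w, u => cut p q j (mul w u)

/-- The number of edges. -/
def len : NWord → ℕ
  | flat p q => p + q
  | cut p q _ w => p + q + 1 + len w

/-- The word is a path with range the vertex `n`: an edge `γ^{(j)}` at the vertex `m` needs
`j < k m`. -/
def Valid (k : ℕ → ℕ) : ℕ → NWord → Prop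
  | _, flat _ _ => True
  | n, cut p q j w => j < k (n + p + q) ∧ Valid k (n + p + q + 1) w

theorem len_mul (u v : NWord) : (mul u v).len = u.len + v.len := by
  induction u with
  | flat p q => cases v <;> simp only [mul, len] <;> omega
  | cut p q j w ih => simp only [mul, len, ih]; omega

theorem mul_assoc' (u v w : NWord) : mul (mul u v) w = mul u (mul v w) := by
  induction u with
  | flat p q => cases v <;> cases w <;> simp [mul, Nat.add_assoc]
  | cut p q j t ih => simp only [mul, ih]

theorem mul_left_cancel' (u v w : NWord) (h : mul u v = mul u w) : v = w := by
  induction u with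
  | flat p q => cases v <;> cases w <;> simp_all [mul]
  | cut p q j t ih => simp only [mul, cut.injEq, true_and] at h; exact ih h

theorem mul_one' (u : NWord) : mul u (flat 0 0) = u := by
  induction u with
  | flat p q => rfl
  | cut p q j t ih => simp only [mul, ih]

theorem one_mul' (u : NWord) : mul (flat 0 0) u = u := by
  cases u <;> simp [mul]

theorem valid_mul (k : ℕ → ℕ) (u v : NWord) (n : ℕ) (hu : Valid k n u)
    (hv : Valid k (n + u.len) v) : Valid k n (mul u v) := by
  induction u generalizing n with
  | flat p q =>
    cases v with
    | flat p' q' => trivial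
    | cut p' q' j w =>
      simp only [len, Valid, mul] at hv ⊢
      rw [show n + (p + p') + (q + q') = n + (p + q) + p' + q' by omega]
      exact hv
  | cut p q j w ih =>
    simp only [Valid, mul] at hu ⊢
    refine ⟨hu.1, ih _ hu.2 ?_⟩
    simp only [len] at hv
    rw [show n + p + q + 1 + w.len = n + (p + q + 1 + w.len) by omega]
    exact hv

end NWord

/-- The morphisms of the category of paths `Λ` attached to `k`. -/
@[ext] structure Lam (k : ℕ → ℕ) where
  /-- the range of the path -/
  rng : ℕ
  word : NWord
  valid : word.Valid k rng

namespace Lam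

variable {k : ℕ → ℕ}

/-- The length `|λ|`. -/
def len (l : Lam k) : ℕ := l.word.len

/-- The source of the path. -/
def src (l : Lam k) : ℕ := l.rng + l.len

/-- The composition `λμ`, defined when `s(λ) = r(μ)`. -/
def comp (l m : Lam k) (h : l.src = m.rng) : Lam k where
  rng := l.rng
  word := l.word.mul m.word
  valid := NWord.valid_mul k _ _ _ l.valid (by have := m.valid; rw [← h] at this; exact this)

/-- The unit at the vertex `n`. -/
def unit (k : ℕ → ℕ) (n : ℕ) : Lam k := ⟨n, .flat 0 0, trivial⟩

/-- The edge `α` with range `n`. -/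
def alpha (k : ℕ → ℕ) (n : ℕ) : Lam k := ⟨n, .flat 1 0, trivial⟩

/-- The path `β^q` with range `n`. -/
def betaPow (k : ℕ → ℕ) (n q : ℕ) : Lam k := ⟨n, .flat 0 q, trivial⟩

/-- The edge `β` with range `n`. -/
def beta (k : ℕ → ℕ) (n : ℕ) : Lam k := betaPow k n 1

/-- The edge `γ^{(j)}` with range `n`, where `0 ≤ j < k n`. -/
def gamma (k : ℕ → ℕ) (n j : ℕ) (hj : j < k n) : Lam k := ⟨n, .cut 0 0 j (.flat 0 0), hj, trivial⟩

/-- `l` is a prefix of `m`, that is, `m` extends `l`. -/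
def IsPrefix (l m : Lam k) : Prop := ∃ (n : Lam k) (h : l.src = n.rng), m = l.comp n h

theorem src_comp (l m : Lam k) (h : l.src = m.rng) : (l.comp m h).src = m.src := by
  have h' : l.rng + l.word.len = m.rng := h
  simp only [src, len, comp, NWord.len_mul]
  omega

theorem comp_assoc (l m n : Lam k) (h : l.src = m.rng) (h' : m.src = n.rng) :
    (l.comp m h).comp n ((src_comp l m h).trans h') = l.comp (m.comp n h') h := by
  ext1
  · rfl
  · exact NWord.mul_assoc' _ _ _

theorem comp_left_cancel (l m n : Lam k) (h : l.src = m.rng) (h' : l.src = n.rng)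
    (e : l.comp m h = l.comp n h') : m = n := by
  ext1
  · exact h.symm.trans h'
  · exact NWord.mul_left_cancel' _ _ _ (congrArg word e)

theorem IsPrefix.refl (l : Lam k) : l.IsPrefix l :=
  ⟨unit k l.src, rfl, by ext1; exacts [rfl, (NWord.mul_one' _).symm]⟩

theorem IsPrefix.trans {l m n : Lam k} (h : l.IsPrefix m) (h' : m.IsPrefix n) : l.IsPrefix n := by
  obtain ⟨a, ha, rfl⟩ := h
  obtain ⟨b, hb, rfl⟩ := h'
  exact ⟨a.comp b ((src_comp _ _ ha).symm.trans hb), ha, comp_assoc _ _ _ _ _⟩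

theorem IsPrefix.rng_eq {l m : Lam k} (h : l.IsPrefix m) : l.rng = m.rng := by
  obtain ⟨a, ha, rfl⟩ := h
  rfl

theorem IsPrefix.comp_left {l m : Lam k} (h : l.IsPrefix m) (n : Lam k) (hl : n.src = l.rng)
    (hm : n.src = m.rng) : (n.comp l hl).IsPrefix (n.comp m hm) := by
  obtain ⟨a, ha, rfl⟩ := h
  exact ⟨a, (src_comp _ _ _).trans ha, (comp_assoc _ _ _ _ _).symm⟩

theorem IsPrefix.of_comp_left {l m : Lam k} (n : Lam k) (hl : n.src = l.rng) (hm : n.src = m.rng)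
    (h : (n.comp l hl).IsPrefix (n.comp m hm)) : l.IsPrefix m := by
  obtain ⟨a, ha, e⟩ := h
  have ha' : l.src = a.rng := (src_comp _ _ _).symm.trans ha
  exact ⟨a, ha', comp_left_cancel n _ _ hm hl (e.trans (comp_assoc _ _ _ _ _))⟩

end Lam

open Lam

/-! ## Directed hereditary sets and the boundary -/

/-- The elements of `Λ*`: the (nonempty) directed hereditary subsets of `Λ`. -/
@[ext] structure DHSet (k : ℕ → ℕ) where
  carrier : Set (Lam k)
  nonempty : carrier.Nonempty
  directed : ∀ m ∈ carrier, ∀ n ∈ carrier, ∃ l ∈ carrier, m.IsPrefix l ∧ n.IsPrefix l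
  hereditary : ∀ m ∈ carrier, ∀ l : Lam k, l.IsPrefix m → l ∈ carrier

namespace DHSet

variable {k : ℕ → ℕ}

/-- `r(x) = n`; all elements of `x` have the same range. -/
def HasRange (x : DHSet k) (n : ℕ) : Prop := ∀ l ∈ x.carrier, l.rng = n

/-- The cylinder set `Z(μ)` in `Λ*`. -/
def Z (m : Lam k) : Set (DHSet k) := {x | m ∈ x.carrier}

/-- `μx`, the set of all prefixes of the paths `μν` with `ν ∈ x`, defined when `s(μ) = r(x)`. -/
def act (m : Lam k) (x : DHSet k) (h : x.HasRange m.src) : DHSet k where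
  carrier := {l | ∃ (n : Lam k) (hn : n ∈ x.carrier), l.IsPrefix (m.comp n (h n hn).symm)}
  nonempty := by
    obtain ⟨n, hn⟩ := x.nonempty
    exact ⟨_, n, hn, IsPrefix.refl _⟩
  directed := by
    rintro a ⟨n, hn, ha⟩ b ⟨n', hn', hb⟩
    obtain ⟨l, hl, h1, h2⟩ := x.directed n hn n' hn'
    exact ⟨_, ⟨l, hl, IsPrefix.refl _⟩, ha.trans (h1.comp_left _ _ _), hb.trans (h2.comp_left _ _ _)⟩
  hereditary := by
    rintro a ⟨n, hn, ha⟩ l hl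
    exact ⟨n, hn, hl.trans ha⟩

/-- The topology on `Λ*` with base the sets `Z(λ) \ (Z(μ₁) ∪ ⋯ ∪ Z(μₜ))`. -/
instance : TopologicalSpace (DHSet k) :=
  TopologicalSpace.generateFrom {U | ∃ (l : Lam k) (F : Finset (Lam k)), U = Z l \ ⋃ m ∈ F, Z m}

/-- The set `Λ**` of maximal directed hereditary sets. -/
def maximals (k : ℕ → ℕ) : Set (DHSet k) := {x | ∀ y : DHSet k, x.carrier ⊆ y.carrier → y = x}

/-- The boundary `∂Λ`. -/
def boundary (k : ℕ → ℕ) : Set (DHSet k) := closure (maximals k)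

/-- The transversal `X = v₁∂Λ`. -/
def X (k : ℕ → ℕ) : Set (DHSet k) := {x | x ∈ boundary k ∧ x.HasRange 0}

theorem HasRange.act {x : DHSet k} {m : Lam k} (h : x.HasRange m.src) :
    (act m x h).HasRange m.rng := by
  rintro l ⟨n, hn, hl⟩
  exact hl.rng_eq

theorem act_act (m n : Lam k) (x : DHSet k) (hmn : m.src = n.rng) (hx : x.HasRange n.src)
    (h1 : (act n x hx).HasRange m.src) (h2 : x.HasRange (m.comp n hmn).src) :
    act m (act n x hx) h1 = act (m.comp n hmn) x h2 := by
  ext l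
  constructor
  · rintro ⟨a, ⟨b, hb, hab⟩, hl⟩
    refine ⟨b, hb, hl.trans ?_⟩
    rw [comp_assoc _ _ _ _ (hx b hb).symm]
    exact hab.comp_left _ _ _
  · rintro ⟨b, hb, hl⟩
    refine ⟨n.comp b (hx b hb).symm, ⟨b, hb, IsPrefix.refl _⟩, ?_⟩
    rw [comp_assoc _ _ _ _ (hx b hb).symm] at hl
    exact hl

theorem act_injective (m : Lam k) (x y : DHSet k) (hx : x.HasRange m.src) (hy : y.HasRange m.src)
    (e : act m x hx = act m y hy) : x = y := by
  have key : ∀ (x y : DHSet k) (hx : x.HasRange m.src) (hy : y.HasRange m.src),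
      act m x hx = act m y hy → x.carrier ⊆ y.carrier := by
    intro x y hx hy e n hn
    have h1 : m.comp n (hx n hn).symm ∈ (act m x hx).carrier := ⟨n, hn, IsPrefix.refl _⟩
    rw [e] at h1
    obtain ⟨n', hn', h2⟩ := h1
    exact y.hereditary n' hn' n (h2.of_comp_left _ _ _)
  exact DHSet.ext (Set.Subset.antisymm (key x y hx hy e) (key y x hy hx e.symm))

theorem isOpen_hasRange (n : ℕ) : IsOpen {x : DHSet k | x.HasRange n} := by
  have : {x : DHSet k | x.HasRange n} = Z (unit k n) \ ⋃ m ∈ (∅ : Finset (Lam k)), Z m := by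
    ext x
    simp only [Finset.notMem_empty, Set.iUnion_of_empty, Set.iUnion_empty, Set.sdiff_empty]
    constructor
    · intro h
      obtain ⟨l, hl⟩ := x.nonempty
      refine x.hereditary l hl _ ⟨l, ?_, ?_⟩
      · simpa [src, len, unit, NWord.len] using (h l hl).symm
      · ext1
        · exact h l hl
        · exact (NWord.one_mul' _).symm
    · intro h l hl
      obtain ⟨a, -, h1, h2⟩ := x.directed _ h l hl
      exact h2.rng_eq.trans h1.rng_eq.symm
  rw [this]
  exact TopologicalSpace.isOpen_generateFrom_of_mem ⟨_, _, rfl⟩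

end DHSet

open DHSet

/-! ## The groupoid -/

/-- The triples `(μ, ν, x)` with `s(μ) = s(ν) = r(x)`. -/
structure Triple (k : ℕ → ℕ) where
  fst : Lam k
  snd : Lam k
  pt : DHSet k
  hfst : pt.HasRange fst.src
  hsnd : pt.HasRange snd.src

namespace Triple

variable {k : ℕ → ℕ}

/-- The relation `(μ, ν, ηx) ∼ (μη, νη, x)`. -/
inductive Step : Triple k → Triple k → Prop
  | mk (m n e : Lam k) (x : DHSet k) (hm : m.src = e.rng) (hn : n.src = e.rng)
      (hx : x.HasRange e.src) :
      Step ⟨m, n, act e x hx, hm.symm ▸ hx.act, hn.symm ▸ hx.act⟩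
        ⟨m.comp e hm, n.comp e hn, x, (src_comp m e hm).symm ▸ hx, (src_comp n e hn).symm ▸ hx⟩

end Triple

/-- The groupoid `G(Λ)`: triples modulo the equivalence relation generated by `Triple.Step`. -/
def GLam (k : ℕ → ℕ) : Type := Quot (Triple.Step (k := k))

namespace GLam

variable {k : ℕ → ℕ}

/-- The class `[μ, ν, x]`. -/
def cls (t : Triple k) : GLam k := Quot.mk _ t

/-- `r([μ, ν, x]) = μx`. -/
def r : GLam k → DHSet k :=
  Quot.lift (fun t => act t.fst t.pt t.hfst) (by
    intro a b h
    cases h with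
    | mk m n e x hm hn hx => exact act_act m e x hm hx _ _)

/-- `s([μ, ν, x]) = νx`. -/
def s : GLam k → DHSet k :=
  Quot.lift (fun t => act t.snd t.pt t.hsnd) (by
    intro a b h
    cases h with
    | mk m n e x hm hn hx => exact act_act n e x hn hx _ _)

/-- `[μ, ν, x]⁻¹ = [ν, μ, x]`. -/
def inv : GLam k → GLam k :=
  Quot.map (fun t => ⟨t.snd, t.fst, t.pt, t.hsnd, t.hfst⟩)
    (by
      intro a b h
      cases h with
      | mk m n e x hm hn hx => exact Triple.Step.mk n m e x hn hm hx)

/-- `IsProd a b c`: the product `ab` is defined and equals `c`, according to the rule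
`[μ, ν, x] [ν, η, x] = [μ, η, x]`. -/
def IsProd (a b c : GLam k) : Prop :=
  ∃ (m n e : Lam k) (x : DHSet k) (hm : x.HasRange m.src) (hn : x.HasRange n.src)
    (he : x.HasRange e.src),
    a = cls ⟨m, n, x, hm, hn⟩ ∧ b = cls ⟨n, e, x, hn, he⟩ ∧ c = cls ⟨m, e, x, hm, he⟩

/-- The set `[μ, ν, E] = {[μ, ν, x] : x ∈ E}`. -/
def bis (m n : Lam k) (E : Set (DHSet k)) : Set (GLam k) :=
  {a | ∃ (x : DHSet k) (hm : x.HasRange m.src) (hn : x.HasRange n.src),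
    x ∈ E ∧ a = cls ⟨m, n, x, hm, hn⟩}

/-- The topology on `G(Λ)` with base the sets `[μ, ν, E]`, `E` open. (As `Λ*` has a base of compact
open sets, compact open sets `E` give the same topology.) -/
instance : TopologicalSpace (GLam k) :=
  TopologicalSpace.generateFrom
    {U | ∃ (m n : Lam k) (E : Set (DHSet k)), IsOpen E ∧ U = bis m n E}

end GLam

/-- The groupoid `G = G(Λ)|_X`, with the subspace topology. -/
def G (k : ℕ → ℕ) : Type := {a : GLam k // a.r ∈ X k ∧ a.s ∈ X k}

namespace G

variable {k : ℕ → ℕ}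

instance : TopologicalSpace (G k) := instTopologicalSpaceSubtype

/-- The source map. -/
def s (a : G k) : DHSet k := a.1.s

/-- The range map. -/
def r (a : G k) : DHSet k := a.1.r

/-- The inverse. -/
def inv (a : G k) : G k :=
  ⟨a.1.inv, by obtain ⟨⟨t⟩, h⟩ := a; exact ⟨h.2, h.1⟩⟩

/-- `IsProd a b c`: the product `ab` is defined in `G` and equals `c`. -/
def IsProd (a b c : G k) : Prop := GLam.IsProd a.1 b.1 c.1

/-- `[μ, ν, E]` as a subset of `G`. -/
def bis (m n : Lam k) (E : Set (DHSet k)) : Set (G k) := {a | a.1 ∈ GLam.bis m n E}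

/-- The convolution product `(f * g)(c) = ∑_{ab = c} f(a) g(b)`; the sum is finite when `f` and `g`
are compactly supported. -/
def conv (f g : G k → ℂ) (c : G k) : ℂ :=
  ∑ᶠ p : {p : G k × G k // IsProd p.1 p.2 c}, f p.1.1 * g p.1.2

/-- The involution `f*(a) = conj f(a⁻¹)`. -/
def starFun (f : G k → ℂ) (a : G k) : ℂ := star (f a.inv)

/-- The `I`-norm of `f`, the larger one of the two numbers `sup_x ∑_{s(a) = x} |f(a)|` and
`sup_x ∑_{r(a) = x} |f(a)|`. -/
def iNorm (f : G k → ℂ) : ℝ≥0∞ :=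
  max (⨆ x : DHSet k, ∑' a : {a : G k // a.s = x}, ‖f a.1‖ₑ)
    (⨆ x : DHSet k, ∑' a : {a : G k // a.r = x}, ‖f a.1‖ₑ)

theorem isOpen_bis_univ (m n : Lam k) : IsOpen (bis m n Set.univ) :=
  have h : IsOpen (GLam.bis m n (Set.univ : Set (DHSet k))) :=
    TopologicalSpace.isOpen_generateFrom_of_mem ⟨m, n, Set.univ, isOpen_univ, rfl⟩
  h.preimage continuous_subtype_val

theorem mem_bis_self (a : G k) : ∃ m n : Lam k, a ∈ bis m n Set.univ := by
  obtain ⟨⟨t⟩, h⟩ := a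
  exact ⟨t.fst, t.snd, t.pt, t.hfst, t.hsnd, trivial, rfl⟩

theorem bis_injOn (m n : Lam k) (a b : G k) (ha : a ∈ bis m n Set.univ)
    (hb : b ∈ bis m n Set.univ) (h : a.s = b.s ∨ a.r = b.r) : a = b := by
  obtain ⟨a, ha'⟩ := a
  obtain ⟨b, hb'⟩ := b
  obtain ⟨x, h1, h2, -, e⟩ := ha
  obtain ⟨y, h3, h4, -, e'⟩ := hb
  dsimp only at e e'
  subst e e'
  have : x = y := by
    rcases h with h | h
    · exact act_injective n x y h2 h4 h
    · exact act_injective m x y h1 h3 h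
  subst this
  rfl

/-- The `I`-norm is finite on compactly supported continuous functions. -/
theorem iNorm_lt_top (f : C_c(G k, ℂ)) : iNorm f < ∞ := by
  classical
  obtain ⟨M, hM⟩ : ∃ M : ℝ, ∀ a, ‖f a‖ ≤ M :=
    (map_continuous f).bounded_above_of_compact_support f.hasCompactSupport
  obtain ⟨t, ht⟩ := IsCompact.elim_finite_subcover (s := tsupport f) f.hasCompactSupport
    (fun p : Lam k × Lam k => bis p.1 p.2 Set.univ) (fun p => isOpen_bis_univ p.1 p.2)
    (fun a _ => by
      obtain ⟨m, n, h⟩ := mem_bis_self a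
      exact Set.mem_iUnion.2 ⟨(m, n), h⟩)
  have bound : ∀ P : G k → Prop, (∀ m n, ∀ a b : G k, P a → P b → a ∈ bis m n Set.univ →
      b ∈ bis m n Set.univ → a = b) →
      ∑' a : {a : G k // P a}, ‖f a.1‖ₑ ≤ t.card * ENNReal.ofReal M := by
    intro P hP
    calc ∑' a : {a : G k // P a}, ‖f a.1‖ₑ
        ≤ ∑' a : {a : G k // P a}, ∑ p ∈ t,
            (if a.1 ∈ bis p.1 p.2 Set.univ then ENNReal.ofReal M else 0) := by
          refine ENNReal.tsum_le_tsum fun a => ?_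
          by_cases ha : f a.1 = 0
          · simp [ha]
          · obtain ⟨p, hp, hap⟩ := Set.mem_iUnion₂.1 (ht (subset_tsupport f ha))
            refine le_trans ?_ (Finset.single_le_sum (f := fun p : Lam k × Lam k =>
              if a.1 ∈ bis p.1 p.2 Set.univ then ENNReal.ofReal M else 0)
              (fun _ _ => bot_le) hp)
            simp only [hap, if_true]
            rw [← ofReal_norm]
            exact ENNReal.ofReal_le_ofReal (hM _)
      _ = ∑ p ∈ t, ∑' a : {a : G k // P a},
            (if a.1 ∈ bis p.1 p.2 Set.univ then ENNReal.ofReal M else 0) :=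
          Summable.tsum_finsetSum fun _ _ => ENNReal.summable
      _ ≤ ∑ p ∈ t, ENNReal.ofReal M := by
          refine Finset.sum_le_sum fun p _ => ?_
          by_cases h : ∃ a : {a : G k // P a}, a.1 ∈ bis p.1 p.2 Set.univ
          · obtain ⟨a, ha⟩ := h
            rw [tsum_eq_single a]
            · simp [ha]
            · intro b hb
              rw [if_neg]
              intro hb'
              exact hb (Subtype.ext (hP p.1 p.2 b.1 a.1 b.2 a.2 hb' ha))
          · push Not at h
            simp [h]
      _ = t.card * ENNReal.ofReal M := by simp
  have fin : (t.card : ℝ≥0∞) * ENNReal.ofReal M < ∞ :=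
    ENNReal.mul_lt_top (ENNReal.natCast_lt_top _) ENNReal.ofReal_lt_top
  refine lt_of_le_of_lt (max_le (iSup_le fun x => bound _ ?_) (iSup_le fun x => bound _ ?_)) fin
  · exact fun m n a b ha hb h h' => bis_injOn m n a b h h' (.inl (ha.trans hb.symm))
  · exact fun m n a b ha hb h h' => bis_injOn m n a b h h' (.inr (ha.trans hb.symm))

end G

/-! ## The full groupoid C*-algebra -/

/-- The `I`-norm bounded *-representations of the convolution *-algebra `C_c(G)` on Hilbert
spaces. -/
structure Rep (k : ℕ → ℕ) where
  H : Type
  [normedAddCommGroup : NormedAddCommGroup H]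
  [innerProductSpace : InnerProductSpace ℂ H]
  [completeSpace : CompleteSpace H]
  toFun : C_c(G k, ℂ) →ₗ[ℂ] (H →L[ℂ] H)
  map_conv : ∀ f g h : C_c(G k, ℂ), (h : G k → ℂ) = G.conv f g → toFun h = toFun f * toFun g
  map_star : ∀ f h : C_c(G k, ℂ), (h : G k → ℂ) = G.starFun f → toFun h = star (toFun f)
  bounded : ∀ f : C_c(G k, ℂ), ‖toFun f‖ₑ ≤ G.iNorm f

attribute [instance] Rep.normedAddCommGroup Rep.innerProductSpace Rep.completeSpace

/-- The C*-algebra of bounded families of operators indexed by all representations. -/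
abbrev Ambient (k : ℕ → ℕ) : Type 1 := lp (fun p : Rep k => p.H →L[ℂ] p.H) ∞

/-- The universal representation of `C_c(G)`, the direct sum of all representations. -/
def univRep (k : ℕ → ℕ) : C_c(G k, ℂ) →ₗ[ℂ] Ambient k where
  toFun f := ⟨fun p => p.toFun f, memℓp_infty ⟨(G.iNorm f).toReal, by
    rintro _ ⟨p, rfl⟩
    have := ENNReal.toReal_mono (G.iNorm_lt_top f).ne (p.bounded f)
    simpa using this⟩⟩
  map_add' f g := by ext p : 2; exact map_add p.toFun f g
  map_smul' c f := by ext p : 2; exact map_smul p.toFun c f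

/-- The full C*-algebra `C*(G)`, as an algebra of operators: the closure of the image of `C_c(G)`
under the universal representation, so that the norm of `f ∈ C_c(G)` is the supremum of `‖π(f)‖` over
all representations `π`. (The image is already a *-algebra.) -/
def fullAlg (k : ℕ → ℕ) : NonUnitalStarSubalgebra ℂ (Ambient k) :=
  (NonUnitalStarAlgebra.adjoin ℂ (Set.range (univRep k))).topologicalClosure

/-- The full C*-algebra `C*(G)`. -/
def CStarG (k : ℕ → ℕ) : Type 1 := fullAlg k

instance (k : ℕ → ℕ) : NonUnitalCStarAlgebra (CStarG k) :=
  NonUnitalStarSubalgebra.nonUnitalCStarAlgebra (fullAlg k)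
    (h_closed := NonUnitalStarSubalgebra.isClosed_topologicalClosure _)

/-- The canonical map `C_c(G) → C*(G)`. -/
def ofCc (k : ℕ → ℕ) (f : C_c(G k, ℂ)) : CStarG k :=
  ⟨univRep k f, NonUnitalStarSubalgebra.le_topologicalClosure _
    (NonUnitalStarAlgebra.subset_adjoin ℂ _ ⟨f, rfl⟩)⟩

open Classical in
/-- The characteristic function `χ_S ∈ C*(G)` of a compact open (and closed) subset `S` of `G`; it has
the value `0` by convention if `S` is not compact and clopen. -/
def chi (k : ℕ → ℕ) (S : Set (G k)) : CStarG k :=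
  if h : IsCompact S ∧ IsClopen S then
    ofCc k ⟨⟨S.indicator 1, continuous_one.indicator fun a ha => by
        rw [h.2.frontier_eq] at ha; exact ha.elim⟩,
      h.1.of_isClosed_subset isClosed_closure
        (closure_minimal Set.support_indicator_subset h.2.isClosed)⟩
  else 0

/-! ## The AF subalgebra -/

/-- `E_i`, the paths of length `i` with range `v₁`. -/
def setE (k : ℕ → ℕ) (i : ℕ) : Set (Lam k) := {m | m.rng = 0 ∧ m.len = i}

/-- `Φ_i`, the paths of length at most `i` with range `v₁` that are the unit `v₁` or end in an edge
`γ`. -/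
def setPhi (k : ℕ → ℕ) (i : ℕ) : Set (Lam k) :=
  {l | l.rng = 0 ∧ l.len ≤ i ∧
    (l = unit k 0 ∨ ∃ (m : Lam k) (n j : ℕ) (hj : j < k n) (h : m.src = (gamma k n j hj).rng),
      l = m.comp (gamma k n j hj) h)}

/-- `F_i = {ηβ^q : η ∈ Φ_i, |η| + q = i + 1}`. -/
def setF (k : ℕ → ℕ) (i : ℕ) : Set (Lam k) :=
  {m | ∃ e ∈ setPhi k i, ∃ q : ℕ, e.len + q = i + 1 ∧ m = e.comp (betaPow k e.src q) rfl}

/-- The bisections `[ν, μ, Z(β_{i+1})ᶜ]` for `μ, ν ∈ E_i` and `[η, ξ, Z(v_{i+2})]` for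
`ξ, η ∈ F_i`. (In the numbering from `0`, the edge `β_{i+1}` is `beta k i`.) -/
def genSets (k : ℕ → ℕ) (i : ℕ) : Set (Set (G k)) :=
  {S | ∃ m ∈ setE k i, ∃ n ∈ setE k i, S = G.bis n m (Z (beta k i))ᶜ} ∪
    {S | ∃ m ∈ setF k i, ∃ n ∈ setF k i, S = G.bis n m (Z (unit k (i + 1)))}

/-- The finite dimensional C*-algebra `C_i`, generated by the matrix units `χ_S`. -/
def stage (k : ℕ → ℕ) (i : ℕ) : NonUnitalStarSubalgebra ℂ (CStarG k) :=
  NonUnitalStarAlgebra.adjoin ℂ (chi k '' genSets k i)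

/-- The AF subalgebra `C`, the closed *-subalgebra generated by the `C_i`. -/
def subC (k : ℕ → ℕ) : NonUnitalStarSubalgebra ℂ (CStarG k) :=
  (⨆ i, stage k i).topologicalClosure

/-- The bisection `[α, β, Z(v₂)]`, where `α`, `β` are the edges from `v₂` to `v₁`. -/
def twist (k : ℕ → ℕ) : Set (G k) := G.bis (alpha k 0) (beta k 0) (Z (unit k 1))

end PathAmalgam

end

/-! The obstruction is a cocycle. The relations αβ = βα preserve the number of edges α, so [μ, ν, x]
↦ #α(μ) - #α(ν) is a well defined homomorphism c from G to ℤ (`GLam.coc`), and G acts on Λ* × ℤ by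
(s(a), t) ↦ (r(a), t + c(a)). This gives a representation `cocRep` on ℓ²(Λ* × ℤ), bounded by the
I-norm because of Schur's test. Its matrix coefficient `flatCoeff` is a contractive functional on
C*(G): it sums f(a) over the isotropy elements a at the point x = α^∞β^∞ that have c(a) = 1.

On χ of [α, β, Z(v₂)] this functional is 1, since prefixing α or β to the point α^∞β^∞ at v₂ gives x
both times, and the resulting element has c = 1 (`flatCoeff_twist`). It kills every generator
(`flatCoeff_genSets`): if x = μy, then y is again α^∞β^∞ and contains β, so [ν, μ, Z(β)ᶜ] has no
element with source x; and a path in F_i that is a prefix of x can only be β^{i+1}, so the elements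
of [η, ξ, Z(v)] with source and range x have c = 0. By linearity and continuity the functional
vanishes on C, which gives both the non-membership and the norm estimate.

The structure of C rests on prefix combinatorics. The generators of C_i are matrix units: two
different ones have composable elements only if their inner labels agree
(`eq_of_act_eq_of_mem_setE`, `act_ne_act_of_mem_setE_of_mem_setF`, `eq_of_act_eq_of_mem_setF`), so
their span is already a *-algebra. The inclusion C_i ⊆ C_{i+1} subdivides each bisection by the next
edge; every boundary point has one (`exists_edge_mem_of_mem_boundary`).

The characteristic functions are continuous because G is Hausdorff, which follows from right
cancellation in Λ (`GLam.bis_disjoint`). -/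

namespace PathAmalgam

/-! ### Prefixes, least common extensions and cancellation for words in normal form -/

namespace NWord

/-- `u` is a prefix of `w`. -/
def Pre (u w : NWord) : Prop := ∃ t, w = mul u t

theorem Pre.refl (u : NWord) : Pre u u := ⟨_, (mul_one' u).symm⟩

theorem flat_pre_flat {p q p' q' : ℕ} : Pre (flat p q) (flat p' q') ↔ p ≤ p' ∧ q ≤ q' := by
  constructor
  · rintro ⟨t | t, h⟩
    · simp only [mul, flat.injEq] at h; omega
    · simp [mul] at h
  · rintro ⟨h, h'⟩
    exact ⟨flat (p' - p) (q' - q), by simp [mul, h, h']⟩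

theorem flat_pre_cut {p q p' q' j : ℕ} {w : NWord} :
    Pre (flat p q) (cut p' q' j w) ↔ p ≤ p' ∧ q ≤ q' := by
  constructor
  · rintro ⟨t | t, h⟩
    · simp [mul] at h
    · simp only [mul, cut.injEq] at h; omega
  · rintro ⟨h, h'⟩
    exact ⟨cut (p' - p) (q' - q) j w, by simp [mul, h, h']⟩

theorem not_cut_pre_flat {p q p' q' j : ℕ} {w : NWord} : ¬ Pre (cut p' q' j w) (flat p q) := by
  rintro ⟨t, h⟩
  simp [mul] at h

theorem cut_pre_cut {p q j p' q' j' : ℕ} {w w' : NWord} :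
    Pre (cut p q j w) (cut p' q' j' w') ↔ p = p' ∧ q = q' ∧ j = j' ∧ Pre w w' := by
  constructor
  · rintro ⟨t, h⟩
    simp only [mul, cut.injEq] at h
    exact ⟨h.1.symm, h.2.1.symm, h.2.2.1.symm, t, h.2.2.2⟩
  · rintro ⟨rfl, rfl, rfl, t, rfl⟩
    exact ⟨t, rfl⟩

/-- The least common extension of two words that have a common extension. -/
def sup : NWord → NWord → NWord
  | flat p q, flat p' q' => flat (max p p') (max q q')
  | flat _ _, cut p' q' j w => cut p' q' j w
  | cut p q j w, flat _ _ => cut p q j w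
  | cut p q j w, cut _ _ _ w' => cut p q j (sup w w')

/-- The block α^p β^q in front of a γ is rigid: no extension can change it. So compatible words
agree up to their last common γ, and after it either two flat blocks are joined by maxima or a flat
block is absorbed. -/
theorem sup_spec (u v w : NWord) (hu : Pre u w) (hv : Pre v w) :
    Pre u (sup u v) ∧ Pre v (sup u v) ∧ ∀ w', Pre u w' → Pre v w' → Pre (sup u v) w' := by
  induction u generalizing v w with
  | flat p q =>
    cases v with
    | flat p' q' =>
      refine ⟨by simp [sup, flat_pre_flat], by simp [sup, flat_pre_flat], fun w' h h' => ?_⟩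
      cases w' <;> simp only [sup, flat_pre_flat, flat_pre_cut] at * <;> omega
    | cut p' q' j t =>
      cases w with
      | flat => exact absurd hv not_cut_pre_flat
      | cut =>
        rw [flat_pre_cut] at hu
        rw [cut_pre_cut] at hv
        refine ⟨?_, Pre.refl _, fun w' _ h' => h'⟩
        rw [sup, flat_pre_cut]; omega
  | cut p q j t ih =>
    cases w with
    | flat => exact absurd hu not_cut_pre_flat
    | cut a b c w =>
      rw [cut_pre_cut] at hu
      cases v with
      | flat p' q' =>
        rw [flat_pre_cut] at hv
        refine ⟨Pre.refl _, ?_, fun w' h _ => h⟩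
        rw [sup, flat_pre_cut]; omega
      | cut p' q' j' t' =>
        rw [cut_pre_cut] at hv
        obtain ⟨rfl, rfl, rfl, hu⟩ := hu
        obtain ⟨rfl, rfl, rfl, hv⟩ := hv
        obtain ⟨h1, h2, h3⟩ := ih t' w hu hv
        refine ⟨by simpa [sup, cut_pre_cut] using h1, by simpa [sup, cut_pre_cut] using h2, ?_⟩
        intro w' h h'
        cases w' with
        | flat => exact absurd h not_cut_pre_flat
        | cut =>
          rw [cut_pre_cut] at h h'
          rw [sup, cut_pre_cut]
          exact ⟨h.1, h.2.1, h.2.2.1, h3 _ h.2.2.2 h'.2.2.2⟩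

/-- A flat word and a word with a γ cannot become equal after appending the same w: the part of w
behind its first γ would then contain all of w, contradicting length. -/
theorem mul_right_cancel' (u v w : NWord) (h : mul u w = mul v w) : u = v := by
  induction u generalizing v with
  | flat p q =>
    cases v with
    | flat p' q' => cases w <;> simp_all [mul]
    | cut p' q' j t =>
      cases w with
      | flat => simp [mul] at h
      | cut a b c w =>
        simp only [mul, cut.injEq] at h
        have := congrArg len h.2.2.2
        rw [len_mul, len] at this
        omega
  | cut p q j s ih =>
    cases v with
    | flat p' q' =>
      cases w with
      | flat => simp [mul] at h
      | cut a b c w =>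
        simp only [mul, cut.injEq] at h
        have := congrArg len h.2.2.2
        rw [len_mul, len] at this
        omega
    | cut p' q' j' t =>
      simp only [mul, cut.injEq] at h
      rw [h.1, h.2.1, h.2.2.1, ih t h.2.2.2]

theorem valid_of_mul {k : ℕ → ℕ} {u v : NWord} {n : ℕ} (h : Valid k n (mul u v)) :
    Valid k n u ∧ Valid k (n + u.len) v := by
  induction u generalizing n with
  | flat p q =>
    refine ⟨trivial, ?_⟩
    cases v with
    | flat => trivial
    | cut p' q' j w =>
      simp only [mul, Valid, len] at h ⊢
      rw [show n + (p + p') + (q + q') = n + (p + q) + p' + q' by omega] at h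
      exact h
  | cut p q j w ih =>
    simp only [mul, Valid] at h ⊢
    obtain ⟨h1, h2⟩ := ih h.2
    refine ⟨⟨h.1, h1⟩, ?_⟩
    rw [len, show n + (p + q + 1 + w.len) = n + p + q + 1 + w.len by omega]
    exact h2

/-- The number of edges `α` of a word. -/
def alphaCount : NWord → ℕ
  | flat p _ => p
  | cut p _ _ w => p + alphaCount w

theorem alphaCount_mul (u v : NWord) : alphaCount (mul u v) = alphaCount u + alphaCount v := by
  induction u with
  | flat p q => cases v <;> simp only [mul, alphaCount, Nat.add_assoc]
  | cut p q j w ih => simp only [mul, alphaCount, ih]; omega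

end NWord

open NWord

/-! ### The prefix order on Λ -/

namespace Lam

variable {k : ℕ → ℕ}

theorem isPrefix_iff {l m : Lam k} : l.IsPrefix m ↔ l.rng = m.rng ∧ Pre l.word m.word := by
  constructor
  · rintro ⟨n, h, rfl⟩
    exact ⟨rfl, n.word, rfl⟩
  · rintro ⟨h, t, ht⟩
    have hv := m.valid
    rw [ht, ← h] at hv
    exact ⟨⟨l.src, t, (valid_of_mul hv).2⟩, rfl, by ext1; exacts [h.symm, ht]⟩

theorem exists_sup {l m n : Lam k} (hl : l.IsPrefix n) (hm : m.IsPrefix n) :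
    ∃ c : Lam k, l.IsPrefix c ∧ m.IsPrefix c ∧
      ∀ d : Lam k, l.IsPrefix d → m.IsPrefix d → c.IsPrefix d := by
  simp only [isPrefix_iff] at *
  obtain ⟨h1, h2, h3⟩ := sup_spec _ _ _ hl.2 hm.2
  obtain ⟨t, ht⟩ := h3 _ hl.2 hm.2
  have hv := n.valid
  rw [ht] at hv
  exact ⟨⟨n.rng, _, (valid_of_mul hv).1⟩, ⟨hl.1, h1⟩, ⟨hm.1, h2⟩,
    fun d hd hd' => ⟨hl.1.symm.trans hd.1, h3 _ hd.2 hd'.2⟩⟩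

end Lam

open Lam

/-! ### Directed hereditary sets: shifts and cylinder sets -/

namespace DHSet

variable {k : ℕ → ℕ}

theorem hasRange_of_mem {x : DHSet k} {l : Lam k} (h : l ∈ x.carrier) : x.HasRange l.rng := by
  intro m hm
  obtain ⟨a, -, h1, h2⟩ := x.directed _ h m hm
  exact h2.rng_eq.trans h1.rng_eq.symm

theorem HasRange.unique {x : DHSet k} {a b : ℕ} (ha : x.HasRange a) (hb : x.HasRange b) : a = b := by
  obtain ⟨l, hl⟩ := x.nonempty
  exact (ha l hl).symm.trans (hb l hl)

theorem exists_hasRange (x : DHSet k) : ∃ n, x.HasRange n := by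
  obtain ⟨l, hl⟩ := x.nonempty
  exact ⟨_, hasRange_of_mem hl⟩

theorem unit_mem_iff {x : DHSet k} {n : ℕ} : unit k n ∈ x.carrier ↔ x.HasRange n := by
  refine ⟨fun h => hasRange_of_mem h, fun h => ?_⟩
  obtain ⟨l, hl⟩ := x.nonempty
  exact x.hereditary l hl _ (isPrefix_iff.2 ⟨(h l hl).symm, _, (one_mul' _).symm⟩)

theorem comp_mem_act {m n : Lam k} {x : DHSet k} (h : m.src = n.rng) (hx : x.HasRange m.src) :
    m.comp n h ∈ (act m x hx).carrier ↔ n ∈ x.carrier := by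
  constructor
  · rintro ⟨n', hn', h2⟩
    exact x.hereditary n' hn' n (h2.of_comp_left _ _ _)
  · exact fun hn => ⟨n, hn, IsPrefix.refl _⟩

theorem self_mem_act (m : Lam k) (x : DHSet k) (hx : x.HasRange m.src) :
    m ∈ (act m x hx).carrier := by
  obtain ⟨n, hn⟩ := x.nonempty
  exact ⟨n, hn, _, (hx n hn).symm, rfl⟩

/-- The extensions of m are cofinal in x by directedness, so deleting m from them loses nothing. -/
theorem exists_eq_act {m : Lam k} {x : DHSet k} (h : m ∈ x.carrier) :
    ∃ (y : DHSet k) (hy : y.HasRange m.src), x = act m y hy := by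
  have key : ∀ l ∈ x.carrier, ∃ (n : Lam k) (hn : m.src = n.rng),
      m.comp n hn ∈ x.carrier ∧ l.IsPrefix (m.comp n hn) := by
    intro l hl
    obtain ⟨a, ha, ⟨n, hn, rfl⟩, h2⟩ := x.directed _ h l hl
    exact ⟨n, hn, ha, h2⟩
  let y : DHSet k :=
    { carrier := {n | ∃ hn : m.src = n.rng, m.comp n hn ∈ x.carrier}
      nonempty := by
        obtain ⟨n, hn, h1, -⟩ := key m h
        exact ⟨n, hn, h1⟩
      directed := by
        rintro a ⟨ha, ha'⟩ b ⟨hb, hb'⟩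
        obtain ⟨c, hc, h1, h2⟩ := x.directed _ ha' _ hb'
        obtain ⟨n, hn, h3, h4⟩ := key c hc
        exact ⟨n, ⟨hn, h3⟩, (h1.trans h4).of_comp_left _ _ _, (h2.trans h4).of_comp_left _ _ _⟩
      hereditary := by
        rintro a ⟨ha, ha'⟩ b hb
        have hb' := ha.trans hb.rng_eq.symm
        exact ⟨hb', x.hereditary _ ha' _ (hb.comp_left m hb' ha)⟩ }
  have hy : y.HasRange m.src := fun l hl => hl.1.symm
  refine ⟨y, hy, ?_⟩
  ext l
  constructor
  · intro hl
    obtain ⟨n, hn, h3, h4⟩ := key l hl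
    exact ⟨n, ⟨hn, h3⟩, h4⟩
  · rintro ⟨n, ⟨hn, h3⟩, h4⟩
    exact x.hereditary _ h3 _ h4

/-! ### Topology -/

theorem isOpen_Z (l : Lam k) : IsOpen (Z l) :=
  TopologicalSpace.isOpen_generateFrom_of_mem ⟨l, ∅, by simp⟩

theorem isClopen_Z (l : Lam k) : IsClopen (Z l) := by
  refine ⟨⟨?_⟩, isOpen_Z l⟩
  have : (Z l)ᶜ = ⋃ n, (Z (unit k n) \ ⋃ m ∈ ({l} : Finset (Lam k)), Z m) := by
    ext x
    simp only [Finset.mem_singleton, Set.iUnion_iUnion_eq_left, Set.mem_iUnion, Set.mem_sdiff,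
      Set.mem_compl_iff, exists_and_right, iff_and_self]
    intro _
    obtain ⟨n, hn⟩ := x.exists_hasRange
    exact ⟨n, unit_mem_iff.2 hn⟩
  rw [this]
  exact isOpen_iUnion fun n => TopologicalSpace.isOpen_generateFrom_of_mem ⟨_, _, rfl⟩

theorem continuous_of_isClopen {T : Type*} [TopologicalSpace T] {f : T → DHSet k}
    (h : ∀ l, IsClopen (f ⁻¹' Z l)) : Continuous f := by
  refine continuous_generateFrom_iff.2 ?_
  rintro _ ⟨l, F, rfl⟩
  rw [Set.preimage_sdiff, Set.preimage_iUnion₂]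
  exact (h l).isOpen.sdiff (F.finite_toSet.isClosed_biUnion fun m _ => (h m).isClosed)

instance : T2Space (DHSet k) := by
  refine ⟨fun x y hxy => ?_⟩
  by_cases h : x.carrier ⊆ y.carrier
  · have h' : ¬ y.carrier ⊆ x.carrier := fun h' => hxy (DHSet.ext (h.antisymm h'))
    obtain ⟨l, hl, hl'⟩ := Set.not_subset.1 h'
    exact ⟨(Z l)ᶜ, Z l, (isClopen_Z l).compl.isOpen, isOpen_Z l, hl', hl, disjoint_compl_left⟩
  · obtain ⟨l, hl, hl'⟩ := Set.not_subset.1 h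
    exact ⟨Z l, (Z l)ᶜ, isOpen_Z l, (isClopen_Z l).compl.isOpen, hl, hl', disjoint_compl_right⟩

/-- An ultrafilter F on the cylinder converges to {l : Z(l) ∈ F}. This set is directed because Z(a)
∩ Z(b), when nonempty, lies in a single cylinder, that of the least common extension of a and b. -/
theorem isCompact_Z (m : Lam k) : IsCompact (Z m) := by
  rw [isCompact_iff_ultrafilter_le_nhds]
  intro F hF
  rw [Filter.le_principal_iff] at hF
  let x : DHSet k :=
    { carrier := {l | Z l ∈ F}
      nonempty := ⟨m, hF⟩
      directed := by
        intro a ha b hb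
        have hab := Filter.inter_mem ha hb
        obtain ⟨y, hya, hyb⟩ := F.nonempty_of_mem hab
        obtain ⟨l, -, h1, h2⟩ := y.directed a hya b hyb
        -- The least common extension c does not depend on y, so it serves all points of Z(a) ∩ Z(b)
        -- at once.
        obtain ⟨c, h3, h4, h5⟩ := exists_sup h1 h2
        refine ⟨c, ?_, h3, h4⟩
        refine Filter.mem_of_superset hab ?_
        rintro z ⟨hza, hzb⟩
        obtain ⟨l', hl', h6, h7⟩ := z.directed a hza b hzb
        exact z.hereditary l' hl' c (h5 l' h6 h7)
      hereditary := fun a ha l hl =>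
        Filter.mem_of_superset ha fun z hz => z.hereditary a hz l hl }
  refine ⟨x, hF, ?_⟩
  rw [TopologicalSpace.nhds_generateFrom]
  refine le_iInf₂ fun U hU => ?_
  obtain ⟨hxU, l, S, rfl⟩ := hU
  rw [Filter.le_principal_iff]
  refine Filter.sdiff_mem hxU.1 ?_
  rw [Set.compl_iUnion₂]
  refine (Filter.biInter_finset_mem S).2 fun b hb => ?_
  refine Ultrafilter.compl_mem_iff_notMem.2 fun hb' => hxU.2 ?_
  exact Set.mem_iUnion₂.2 ⟨b, hb, hb'⟩

/-- The map `x ↦ μx`. -/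
def actOn (m : Lam k) (x : {x : DHSet k // x.HasRange m.src}) : DHSet k := act m x.1 x.2

/-- If mc is the least common extension of m and l, the condition l ∈ mx says c ∈ x; without a
common extension it never holds. -/
theorem isClopen_mem_act (m l : Lam k) :
    IsClopen {x : {x : DHSet k // x.HasRange m.src} | l ∈ (actOn m x).carrier} := by
  by_cases h : ∃ x : {x : DHSet k // x.HasRange m.src}, l ∈ (actOn m x).carrier
  · obtain ⟨x, n, hn, hl⟩ := h
    obtain ⟨_, ⟨c, hc, rfl⟩, h4, h5⟩ := exists_sup (l := m) ⟨n, _, rfl⟩ hl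
    convert (isClopen_Z c).preimage continuous_subtype_val using 1
    ext y
    constructor
    · rintro ⟨n', hn', hl'⟩
      exact y.1.hereditary n' hn' c ((h5 _ ⟨n', (y.2 n' hn').symm, rfl⟩ hl').of_comp_left _ _ _)
    · exact fun hy => ⟨c, hy, h4⟩
  · convert isClopen_empty
    ext x
    exact ⟨fun hx => h ⟨x, hx⟩, fun hx => hx.elim⟩

theorem range_actOn (m : Lam k) : Set.range (actOn m) = Z m := by
  ext x
  constructor
  · rintro ⟨y, rfl⟩
    exact self_mem_act m y.1 y.2
  · intro h
    obtain ⟨y, hy, rfl⟩ := exists_eq_act h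
    exact ⟨⟨y, hy⟩, rfl⟩

theorem isOpenEmbedding_actOn (m : Lam k) : Topology.IsOpenEmbedding (actOn m) := by
  have hc : Continuous (actOn m) := continuous_of_isClopen fun l => isClopen_mem_act m l
  refine ⟨⟨⟨le_antisymm hc.le_induced ?_⟩, ?_⟩, ?_⟩
  · refine continuous_iff_le_induced.1 ?_
    refine @continuous_of_isClopen k _ (_) _ fun l => ?_
    by_cases h : m.src = l.rng
    · have := @IsClopen.preimage _ _ (TopologicalSpace.induced (actOn m) inferInstance) _ _
        (isClopen_Z (m.comp l h)) _ continuous_induced_dom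
      convert this using 1
      ext x
      exact (comp_mem_act h x.2).symm
    · have hE : (Subtype.val : {x : DHSet k // x.HasRange m.src} → DHSet k) ⁻¹' Z l = ∅ :=
        Set.eq_empty_of_forall_notMem fun x hx => h (x.2 l hx).symm
      rw [hE]
      exact @isClopen_empty _ (_)
  · rintro ⟨x, hx⟩ ⟨y, hy⟩ h
    exact Subtype.ext (act_injective m x y hx hy h)
  · rw [range_actOn]
    exact isOpen_Z m

theorem act_mem_maximals {m : Lam k} {x : DHSet k} (hx : x.HasRange m.src) :
    act m x hx ∈ maximals k ↔ x ∈ maximals k := by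
  constructor
  · intro h y hy
    obtain ⟨l, hl⟩ := x.nonempty
    have hy' : y.HasRange m.src := hx l hl ▸ hasRange_of_mem (hy hl)
    refine act_injective m _ _ hy' hx (h _ ?_)
    rintro a ⟨n, hn, ha⟩
    exact ⟨n, hy hn, ha⟩
  · intro h y hy
    obtain ⟨z, hz, rfl⟩ := exists_eq_act (hy (self_mem_act m x hx))
    have : z = x := h z fun n hn =>
      (comp_mem_act (hx n hn).symm hz).1 (hy ((comp_mem_act (hx n hn).symm hx).2 hn))
    subst this
    rfl

/-- Taking preimages under an open continuous map commutes with closure. This is applied both to x ↦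
mx and to the inclusion of the open set of points with range s(m), on which maximality of x and of
mx agree. -/
theorem act_mem_boundary {m : Lam k} {x : DHSet k} (hx : x.HasRange m.src) :
    act m x hx ∈ boundary k ↔ x ∈ boundary k := by
  have h1 := (isOpenEmbedding_actOn m).isOpenMap.preimage_closure_eq_closure_preimage
    (isOpenEmbedding_actOn m).continuous (maximals k)
  have h2 := (isOpen_hasRange (k := k) m.src).isOpenMap_subtype_val.preimage_closure_eq_closure_preimage
    continuous_subtype_val (maximals k)
  have h3 : actOn m ⁻¹' maximals k = Subtype.val ⁻¹' maximals k := by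
    ext y
    exact act_mem_maximals y.2
  rw [h3] at h1
  have h4 : (⟨x, hx⟩ : {x : DHSet k // x.HasRange m.src}) ∈ actOn m ⁻¹' boundary k ↔
      (⟨x, hx⟩ : {x : DHSet k // x.HasRange m.src}) ∈ Subtype.val ⁻¹' boundary k := by
    rw [boundary, h1]
    exact (Set.ext_iff.1 h2 ⟨x, hx⟩).symm
  exact h4

theorem act_mem_X {m : Lam k} {x : DHSet k} (hm : m.rng = 0) (hx : x.HasRange m.src) :
    act m x hx ∈ X k ↔ x ∈ boundary k :=
  ⟨fun h => (act_mem_boundary hx).1 h.1, fun h => ⟨(act_mem_boundary hx).2 h, hm ▸ hx.act⟩⟩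

end DHSet

open NWord Lam DHSet

variable {k : ℕ → ℕ}

/-! ### Equality of classes -/

namespace Triple

theorem ext_of_eq {t t' : Triple k} (h1 : t.fst = t'.fst) (h2 : t.snd = t'.snd)
    (h3 : t.pt = t'.pt) : t = t' := by
  cases t; cases t'
  subst h1 h2 h3
  rfl

/-- Two triples that have a common refinement. -/
def Rel (t t' : Triple k) : Prop :=
  ∃ (e e' : Lam k) (y : DHSet k) (h : y.HasRange e.src) (h' : y.HasRange e'.src),
    t.pt = act e y h ∧ t'.pt = act e' y h' ∧ t.fst.rng = t'.fst.rng ∧ t.snd.rng = t'.snd.rng ∧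
    mul t.fst.word e.word = mul t'.fst.word e'.word ∧
    mul t.snd.word e.word = mul t'.snd.word e'.word

/-- Both e and f lie in the directed set ey = fz, hence have a common extension ea = fb there; w is
what remains behind it. This Ore-type property makes `Rel` transitive and products well defined. -/
theorem exists_common_act {e f : Lam k} {y z : DHSet k} (hy : y.HasRange e.src)
    (hz : z.HasRange f.src) (h : act e y hy = act f z hz) :
    ∃ (a b : Lam k) (w : DHSet k) (ha : w.HasRange a.src) (hb : w.HasRange b.src),
      y = act a w ha ∧ z = act b w hb ∧ mul e.word a.word = mul f.word b.word := by
  have hf : f ∈ (act e y hy).carrier := h ▸ self_mem_act f z hz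
  obtain ⟨l, hl, ⟨a, ha, rfl⟩, b, hb, e1⟩ := (act e y hy).directed _ (self_mem_act e y hy) _ hf
  obtain ⟨w, hw, h1⟩ := exists_eq_act hl
  have hwa : w.HasRange a.src := by rw [src_comp] at hw; exact hw
  have hw' : w.HasRange (f.comp b hb).src := e1 ▸ hw
  have hwb : w.HasRange b.src := by rw [src_comp] at hw'; exact hw'
  have ha' : (act a w hwa).HasRange e.src := ha ▸ hwa.act
  have hb' : (act b w hwb).HasRange f.src := hb ▸ hwb.act
  refine ⟨a, b, w, hwa, hwb, ?_, ?_, congrArg Lam.word e1⟩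
  · refine act_injective e _ _ hy ha' ?_
    rw [h1, act_act e a w ha hwa ha' hw]
  · refine act_injective f _ _ hz hb' ?_
    rw [← h, h1, act_act f b w hb hwb hb' hw']
    simp only [e1]

theorem act_mul {e a b : Lam k} {w : DHSet k} (ha : w.HasRange a.src)
    (h : (act a w ha).HasRange e.src) (hb : w.HasRange b.src) (hr : e.rng = b.rng)
    (hw : mul e.word a.word = b.word) : act e (act a w ha) h = act b w hb := by
  have hea : e.src = a.rng := h.unique ha.act
  obtain rfl : e.comp a hea = b := Lam.ext hr hw
  exact act_act _ _ _ _ _ _ _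

theorem exists_comp {e a : Lam k} {w : DHSet k} (ha : w.HasRange a.src)
    (h : (act a w ha).HasRange e.src) :
    ∃ b : Lam k, b.rng = e.rng ∧ b.word = mul e.word a.word ∧ w.HasRange b.src := by
  have hea : e.src = a.rng := h.unique ha.act
  exact ⟨e.comp a hea, rfl, rfl, by rw [src_comp]; exact ha⟩

theorem act_unit {x : DHSet k} {n : ℕ} (h : x.HasRange (unit k n).src) :
    act (unit k n) x h = x := by
  have key : ∀ (m : Lam k) (h : (unit k n).src = m.rng), (unit k n).comp m h = m :=
    fun m h => Lam.ext h (one_mul' _)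
  ext l
  constructor
  · rintro ⟨m, hm, hl⟩
    rw [key] at hl
    exact x.hereditary m hm l hl
  · exact fun hl => ⟨l, hl, by rw [key]; exact IsPrefix.refl _⟩

theorem Rel.refl (t : Triple k) : Rel t t :=
  have h : t.pt.HasRange (unit k t.fst.src).src := t.hfst
  ⟨_, _, _, h, h, (act_unit h).symm, (act_unit h).symm, rfl, rfl, rfl, rfl⟩

theorem Rel.symm {t t' : Triple k} (h : Rel t t') : Rel t' t := by
  obtain ⟨e, e', y, h, h', h1, h2, h3, h4, h5, h6⟩ := h
  exact ⟨e', e, y, h', h, h2, h1, h3.symm, h4.symm, h5.symm, h6.symm⟩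

theorem Rel.trans {t t' t'' : Triple k} (h : Rel t t') (h' : Rel t' t'') : Rel t t'' := by
  obtain ⟨e, e', y, he, he', h1, h2, h3, h4, h5, h6⟩ := h
  obtain ⟨f, f', z, hf, hf', g1, g2, g3, g4, g5, g6⟩ := h'
  obtain ⟨a, b, w, ha, hb, rfl, rfl, hab⟩ := exists_common_act he' hf (h2.symm.trans g1)
  obtain ⟨c, hc1, hc2, hc3⟩ := exists_comp ha he
  obtain ⟨d, hd1, hd2, hd3⟩ := exists_comp hb hf'
  refine ⟨c, d, w, hc3, hd3, h1.trans (act_mul _ _ _ hc1.symm hc2.symm),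
    g2.trans (act_mul _ _ _ hd1.symm hd2.symm), h3.trans g3, h4.trans g4, ?_, ?_⟩
  · rw [hc2, hd2, ← mul_assoc', h5, mul_assoc', hab, ← mul_assoc', g5, mul_assoc']
  · rw [hc2, hd2, ← mul_assoc', h6, mul_assoc', hab, ← mul_assoc', g6, mul_assoc']

theorem Rel.of_step {t t' : Triple k} (h : Step t t') : Rel t t' := by
  cases h with
  | mk m n e x hm hn hx =>
    have h0 : x.HasRange (unit k e.src).src := hx
    exact ⟨e, unit k e.src, x, hx, h0, rfl, (act_unit h0).symm, rfl, rfl, (mul_one' _).symm, (mul_one' _).symm⟩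

end Triple

open Triple

namespace GLam

theorem cls_act {m n e : Lam k} {x : DHSet k} (hx : x.HasRange e.src)
    (hm : (act e x hx).HasRange m.src) (hn : (act e x hx).HasRange n.src)
    (hme : m.src = e.rng) (hne : n.src = e.rng)
    (hm' : x.HasRange (m.comp e hme).src) (hn' : x.HasRange (n.comp e hne).src) :
    cls ⟨m, n, act e x hx, hm, hn⟩ = cls ⟨m.comp e hme, n.comp e hne, x, hm', hn'⟩ :=
  Quot.sound (Step.mk m n e x hme hne hx)

/-- Common refinement is an equivalence relation containing the generating steps, and it is itself
reached by two steps. This replaces chains of steps by one explicit witness. -/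
theorem cls_eq_iff {t t' : Triple k} : cls t = cls t' ↔ Rel t t' := by
  constructor
  · intro h
    have h' := Quot.eqvGen_exact h
    clear h
    induction h' with
    | rel _ _ h => exact Rel.of_step h
    | refl _ => exact Rel.refl _
    | symm _ _ _ ih => exact ih.symm
    | trans _ _ _ _ _ ih ih' => exact ih.trans ih'
  · obtain ⟨m, n, x, hm, hn⟩ := t
    obtain ⟨m', n', x', hm', hn'⟩ := t'
    rintro ⟨e, e', y, h, h', h1, h2, h3, h4, h5, h6⟩
    dsimp only at h1 h2 h3 h4 h5 h6
    subst h1 h2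
    have a1 := hm.unique h.act
    have a2 := hn.unique h.act
    have a3 := hm'.unique h'.act
    have a4 := hn'.unique h'.act
    rw [cls_act h hm hn a1 a2 (by rwa [src_comp]) (by rwa [src_comp]),
      cls_act h' hm' hn' a3 a4 (by rwa [src_comp]) (by rwa [src_comp])]
    exact congrArg cls (ext_of_eq (Lam.ext h3 h5) (Lam.ext h4 h6) rfl)

theorem r_cls (t : Triple k) : (cls t).r = act t.fst t.pt t.hfst := rfl

theorem s_cls (t : Triple k) : (cls t).s = act t.snd t.pt t.hsnd := rfl

/-- The cocycle that counts the edges `α`. -/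
def coc : GLam k → ℤ :=
  Quot.lift (fun t => (t.fst.word.alphaCount : ℤ) - t.snd.word.alphaCount) (by
    intro a b h
    cases h with
    | mk m n e x hm hn hx =>
      simp only [comp, alphaCount_mul]
      push_cast
      ring)

theorem coc_inv (a : GLam k) : a.inv.coc = - a.coc := by
  obtain ⟨t⟩ := a
  exact (neg_sub _ _).symm

theorem r_inv (a : GLam k) : a.inv.r = a.s := by
  obtain ⟨t⟩ := a
  rfl

theorem s_inv (a : GLam k) : a.inv.s = a.r := by
  obtain ⟨t⟩ := a
  rfl

theorem inv_inv (a : GLam k) : a.inv.inv = a := by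
  obtain ⟨t⟩ := a
  rfl

namespace IsProd

theorem r_eq {a b c : GLam k} (h : IsProd a b c) : c.r = a.r := by
  obtain ⟨m, n, e, x, hm, hn, he, rfl, rfl, rfl⟩ := h
  rfl

theorem s_eq {a b c : GLam k} (h : IsProd a b c) : c.s = b.s := by
  obtain ⟨m, n, e, x, hm, hn, he, rfl, rfl, rfl⟩ := h
  rfl

theorem s_eq_r {a b c : GLam k} (h : IsProd a b c) : a.s = b.r := by
  obtain ⟨m, n, e, x, hm, hn, he, rfl, rfl, rfl⟩ := h
  rfl

theorem coc_eq {a b c : GLam k} (h : IsProd a b c) : c.coc = a.coc + b.coc := by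
  obtain ⟨m, n, e, x, hm, hn, he, rfl, rfl, rfl⟩ := h
  exact (sub_add_sub_cancel _ _ _).symm

/-- The refinements that identify the two presentations of a and of b are brought to a common one;
left cancellation of the middle path shows that they match. -/
theorem unique {a b c c' : GLam k} (h : IsProd a b c) (h' : IsProd a b c') : c = c' := by
  obtain ⟨m, n, e, x, hm, hn, he, rfl, rfl, rfl⟩ := h
  obtain ⟨m', n', e', x', hm', hn', he', h1, h2, rfl⟩ := h'
  rw [cls_eq_iff] at h1 h2
  obtain ⟨a, a', y, ha, ha', p1, p2, p3, p4, p5, p6⟩ := h1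
  obtain ⟨b, b', z, hb, hb', q1, q2, q3, q4, q5, q6⟩ := h2
  dsimp only at *
  obtain ⟨u, v, w, hu, hv, rfl, rfl, huv⟩ := exists_common_act ha hb (p1.symm.trans q1)
  obtain ⟨c, hc1, hc2, hc3⟩ := exists_comp hu ha
  obtain ⟨c', hc1', hc2', hc3'⟩ := exists_comp hu ha'
  have huv' : mul a'.word u.word = mul b'.word v.word := by
    apply mul_left_cancel' n'.word
    rw [← mul_assoc', ← p6, mul_assoc', huv, ← mul_assoc', q5, mul_assoc']
  refine cls_eq_iff.2 ⟨c, c', w, hc3, hc3', ?_, ?_, p3, q4, ?_, ?_⟩ <;> dsimp only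
  · exact p1.trans (act_mul _ _ _ hc1.symm hc2.symm)
  · exact p2.trans (act_mul _ _ _ hc1'.symm hc2'.symm)
  · rw [hc2, hc2', ← mul_assoc', p5, mul_assoc']
  · rw [hc2, hc2', huv', huv, ← mul_assoc', q6, mul_assoc']

end IsProd

theorem exists_isProd {a b : GLam k} (h : a.s = b.r) : ∃ c, IsProd a b c := by
  obtain ⟨m, n, x, hm, hn⟩ := a
  obtain ⟨n', e, x', hn', he⟩ := b
  change act n x hn = act n' x' hn' at h
  have hr : n.rng = n'.rng := by
    have := h ▸ hn.act
    exact this.unique hn'.act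
  obtain ⟨u, v, w, hu, hv, rfl, rfl, huv⟩ := exists_common_act hn hn' h
  have a1 := hm.unique hu.act
  have a2 := hn.unique hu.act
  have a3 := hn'.unique hv.act
  have a4 := he.unique hv.act
  refine ⟨_, m.comp u a1, n.comp u a2, e.comp v a4, w, by rwa [src_comp], by rwa [src_comp],
    by rwa [src_comp], cls_act hu hm hn a1 a2 _ _, ?_, rfl⟩
  refine (cls_act hv hn' he a3 a4 (by rwa [src_comp]) (by rwa [src_comp])).trans ?_
  exact congrArg cls (ext_of_eq (Lam.ext hr.symm huv.symm) rfl rfl)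

/-! ### Topology -/

theorem isOpen_bis (m n : Lam k) {E : Set (DHSet k)} (hE : IsOpen E) : IsOpen (bis m n E) :=
  TopologicalSpace.isOpen_generateFrom_of_mem ⟨m, n, E, hE, rfl⟩

theorem isOpen_exists_act_mem (m : Lam k) {U : Set (DHSet k)} (hU : IsOpen U) :
    IsOpen {x : DHSet k | ∃ h : x.HasRange m.src, act m x h ∈ U} := by
  convert (isOpen_hasRange (k := k) m.src).isOpenMap_subtype_val _
    (hU.preimage (isOpenEmbedding_actOn m).continuous) using 1
  ext x
  exact ⟨fun ⟨h, hx⟩ => ⟨⟨x, h⟩, hx, rfl⟩, by rintro ⟨⟨y, h⟩, hx, rfl⟩; exact ⟨h, hx⟩⟩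

theorem continuous_r : Continuous (r : GLam k → DHSet k) := by
  refine continuous_def.2 fun U hU => ?_
  have : r ⁻¹' U = ⋃ (m : Lam k) (n : Lam k),
      bis m n {x | ∃ h : x.HasRange m.src, act m x h ∈ U} := by
    ext a
    simp only [Set.mem_iUnion]
    constructor
    · obtain ⟨t⟩ := a
      exact fun h => ⟨t.fst, t.snd, t.pt, t.hfst, t.hsnd, ⟨t.hfst, h⟩, rfl⟩
    · rintro ⟨m, n, x, hm, hn, ⟨h, hx⟩, rfl⟩
      exact hx
  rw [this]
  exact isOpen_iUnion fun m => isOpen_iUnion fun n => isOpen_bis m n (isOpen_exists_act_mem m hU)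

/-- In a common refinement me = me' forces e = e' by left cancellation, and then ne = n'e forces n =
n' by right cancellation. -/
theorem bis_disjoint {m n n' : Lam k} (h : n ≠ n') :
    Disjoint (bis m n Set.univ) (bis m n' Set.univ) := by
  rw [Set.disjoint_left]
  rintro _ ⟨x, hm, hn, -, rfl⟩ ⟨x', hm', hn', -, e⟩
  obtain ⟨a, b, y, ha, hb, h1, h2, h3, h4, h5, h6⟩ := cls_eq_iff.1 e
  dsimp only at *
  have := mul_left_cancel' _ _ _ h5
  rw [this] at h6
  exact h (Lam.ext h4 (mul_right_cancel' _ _ _ h6))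

instance : T2Space (GLam k) := by
  refine ⟨fun a b hab => ?_⟩
  by_cases hr : a.r = b.r
  -- With equal ranges both elements can be refined to have the same first path; if they differ,
  -- their second paths differ and `bis_disjoint` separates them.
  · obtain ⟨m, n, x, hm, hn⟩ := a
    obtain ⟨m', n', x', hm', hn'⟩ := b
    change act m x hm = act m' x' hm' at hr
    have hrng : m.rng = m'.rng := by
      have := hr ▸ hm.act
      exact this.unique hm'.act
    obtain ⟨u, v, w, hu, hv, rfl, rfl, huv⟩ := exists_common_act hm hm' hr
    have a1 := hm.unique hu.act
    have a2 := hn.unique hu.act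
    have a3 := hm'.unique hv.act
    have a4 := hn'.unique hv.act
    have e1 := cls_act hu hm hn a1 a2 (by rwa [src_comp]) (by rwa [src_comp])
    have e2 := cls_act hv hm' hn' a3 a4 (by rwa [src_comp]) (by rwa [src_comp])
    have e3 : m'.comp v a3 = m.comp u a1 := Lam.ext hrng.symm huv.symm
    change cls _ ≠ cls _ at hab
    refine ⟨bis (m.comp u a1) (n.comp u a2) Set.univ, bis (m.comp u a1) (n'.comp v a4) Set.univ,
      isOpen_bis _ _ isOpen_univ, isOpen_bis _ _ isOpen_univ,
      ⟨w, by rwa [src_comp], by rwa [src_comp], trivial, e1⟩,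
      ⟨w, by rwa [src_comp], by rwa [src_comp], trivial, ?_⟩, bis_disjoint fun e4 => hab ?_⟩
    · exact e2.trans (congrArg cls (ext_of_eq e3 rfl rfl))
    · rw [e1, e2]
      exact congrArg cls (ext_of_eq e3.symm e4 rfl)
  · obtain ⟨U, V, hU, hV, h1, h2, h3⟩ := t2_separation hr
    exact ⟨_, _, hU.preimage continuous_r, hV.preimage continuous_r, h1, h2, h3.preimage _⟩

/-- If [m, n, ay] = [m', n', by] through a common refinement, the same refinement gives [m, n, aw] =
[m', n', bw] for every w of the right range, so it works on a whole neighbourhood. -/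
theorem continuous_cls (m n : Lam k) :
    Continuous fun x : {x : DHSet k // x.HasRange m.src ∧ x.HasRange n.src} =>
      cls ⟨m, n, x.1, x.2.1, x.2.2⟩ := by
  refine continuous_generateFrom_iff.2 ?_
  rintro _ ⟨m', n', E, hE, rfl⟩
  refine isOpen_iff_forall_mem_open.2 ?_
  rintro ⟨x, hx⟩ ⟨x', hm', hn', hxE, e⟩
  obtain ⟨a, b, y, ha, hb, h1, h2, h3, h4, h5, h6⟩ := cls_eq_iff.1 e
  dsimp only at *
  subst h1 h2
  refine ⟨Subtype.val ⁻¹' (actOn a '' (Subtype.val ⁻¹'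
    {z | ∃ h : z.HasRange b.src, act b z h ∈ E})), ?_, ?_, ⟨y, ha⟩, ⟨hb, hxE⟩, rfl⟩
  · rintro ⟨_, hz⟩ ⟨⟨w, hw⟩, ⟨hwb, hwE⟩, rfl⟩
    have e1 := hm'.unique hb.act
    have e2 := hn'.unique hb.act
    refine ⟨act b w hwb, e1 ▸ hwb.act, e2 ▸ hwb.act, hwE, ?_⟩
    exact cls_eq_iff.2 ⟨a, b, w, hw, hwb, rfl, rfl, h3, h4, h5, h6⟩
  · exact ((isOpenEmbedding_actOn a).isOpenMap _
      ((isOpen_exists_act_mem b hE).preimage continuous_subtype_val)).preimage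
      continuous_subtype_val

end GLam

/-! ### Compact open bisections of G -/

namespace G

instance : T2Space (G k) := inferInstanceAs (T2Space (Subtype _))

theorem isOpen_bis (m n : Lam k) {E : Set (DHSet k)} (hE : IsOpen E) : IsOpen (bis m n E) :=
  (GLam.isOpen_bis m n hE).preimage continuous_subtype_val

theorem isCompact_bis {m n : Lam k} (hm : m.rng = 0) (hn : n.rng = 0)
    {E : Set (DHSet k)} (hE : IsClosed E) : IsCompact (bis m n E) := by
  have h1 : IsCompact {x : {x : DHSet k // x.HasRange m.src ∧ x.HasRange n.src} |
      x.1 ∈ boundary k ∩ E} := by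
    rw [Subtype.isCompact_iff]
    have h0 : IsClosed (Z (unit k m.src) ∩ Z (unit k n.src) ∩ (boundary k ∩ E)) :=
      ((isClopen_Z _).isClosed.inter (isClopen_Z _).isClosed).inter (isClosed_closure.inter hE)
    convert (isCompact_Z (unit k m.src)).of_isClosed_subset h0 fun x hx => hx.1.1 using 1
    ext x
    simp only [Set.mem_image, Subtype.exists, Set.mem_inter_iff]
    constructor
    · rintro ⟨y, hy, h, rfl⟩
      exact ⟨⟨unit_mem_iff.2 hy.1, unit_mem_iff.2 hy.2⟩, h⟩
    · rintro ⟨⟨h1, h2⟩, h⟩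
      exact ⟨x, ⟨unit_mem_iff.1 h1, unit_mem_iff.1 h2⟩, h, rfl⟩
  refine Subtype.isCompact_iff.2 ?_
  convert h1.image (GLam.continuous_cls m n) using 1
  ext a
  constructor
  · rintro ⟨⟨a, ha⟩, ⟨x, h2, h3, h4, rfl⟩, rfl⟩
    exact ⟨⟨x, h2, h3⟩, ⟨(act_mem_X hm h2).1 ha.1, h4⟩, rfl⟩
  · rintro ⟨⟨x, h2, h3⟩, ⟨h4, h5⟩, rfl⟩
    exact ⟨⟨GLam.cls ⟨m, n, x, h2, h3⟩, (act_mem_X hm h2).2 h4, (act_mem_X hn h3).2 h4⟩, ⟨x, h2, h3, h5, rfl⟩, rfl⟩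

theorem isCompact_isClopen_bis {m n : Lam k} (hm : m.rng = 0) (hn : n.rng = 0)
    {E : Set (DHSet k)} (hE : IsClopen E) : IsCompact (bis m n E) ∧ IsClopen (bis m n E) :=
  ⟨isCompact_bis hm hn hE.isClosed, (isCompact_bis hm hn hE.isClosed).isClosed,
    isOpen_bis m n hE.isOpen⟩

end G

/-! ### Operators on `ℓ²` given by matrices -/

section Schur

variable {Y : Type*}

/-- The Hilbert space `ℓ²(Y)`. -/
abbrev L2 (Y : Type*) : Type _ := lp (fun _ : Y => ℂ) 2

theorem memℓp_two_of_tsum {f : Y → ℂ} (h : ∑' i, ‖f i‖ₑ ^ 2 ≠ ∞) : Memℓp f 2 := by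
  refine memℓp_gen ?_
  have h1 : ∑' i, ((‖f i‖₊ ^ 2 : NNReal) : ℝ≥0∞) ≠ ∞ := by
    simpa [enorm_eq_nnnorm] using h
  have h2 := NNReal.summable_coe.2 (ENNReal.tsum_coe_ne_top_iff_summable.1 h1)
  simpa using h2

theorem tsum_enorm_sq (f : L2 Y) : ∑' i, ‖f i‖ₑ ^ 2 = ‖f‖ₑ ^ 2 := by
  have h := lp.hasSum_norm (p := 2) (by simp) f
  simp only [ENNReal.toReal_ofNat, Real.rpow_ofNat] at h
  have h1 := ENNReal.ofReal_tsum_of_nonneg (fun i => by positivity) h.summable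
  rw [h.tsum_eq] at h1
  simpa [ENNReal.ofReal_pow, ofReal_norm] using h1.symm

theorem two_mul_mul_le_sq_add_sq (a b : ℝ≥0∞) : 2 * (a * b) ≤ a ^ 2 + b ^ 2 := by
  by_cases ha : a = ∞
  · simp [ha]
  by_cases hb : b = ∞
  · simp [hb]
  lift a to NNReal using ha
  lift b to NNReal using hb
  norm_cast
  rw [← mul_assoc]
  exact two_mul_le_add_sq a b

/-- Weighted Cauchy-Schwarz: the square is a double sum over y and z, to which 2 u_y u_z ≤ u_y² +
u_z² is applied; the two resulting sums agree by symmetry. -/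
theorem tsum_mul_sq_le (k u : Y → ℝ≥0∞) :
    (∑' y, k y * u y) ^ 2 ≤ (∑' y, k y) * ∑' y, k y * u y ^ 2 := by
  have h1 : (∑' y, k y * u y) ^ 2 = ∑' y, ∑' z, k y * k z * (u y * u z) := by
    rw [sq, ← ENNReal.tsum_mul_right]
    refine tsum_congr fun y => ?_
    rw [← ENNReal.tsum_mul_left]
    exact tsum_congr fun z => by ring
  have h2 : (∑' y, k y) * ∑' y, k y * u y ^ 2 = ∑' y, ∑' z, k y * k z * u z ^ 2 := by
    rw [← ENNReal.tsum_mul_right]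
    refine tsum_congr fun y => ?_
    rw [← ENNReal.tsum_mul_left]
    exact tsum_congr fun z => by ring
  have h3 : (∑' y, k y) * ∑' y, k y * u y ^ 2 = ∑' y, ∑' z, k y * k z * u y ^ 2 := by
    rw [h2, ENNReal.tsum_comm]
    exact tsum_congr fun y => tsum_congr fun z => by ring
  have h4 : 2 * (∑' y, k y * u y) ^ 2 ≤ 2 * ((∑' y, k y) * ∑' y, k y * u y ^ 2) := by
    nth_rw 2 [two_mul]
    nth_rw 1 [h3]
    rw [h2, h1, ← ENNReal.tsum_add, ← ENNReal.tsum_mul_left]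
    refine ENNReal.tsum_le_tsum fun y => ?_
    rw [← ENNReal.tsum_add, ← ENNReal.tsum_mul_left]
    refine ENNReal.tsum_le_tsum fun z => ?_
    rw [← mul_add, mul_left_comm]
    gcongr
    exact two_mul_mul_le_sq_add_sq _ _
  exact (ENNReal.mul_le_mul_iff_right (by simp) (by simp)).1 h4

theorem tsum_sq_tsum_mul_le {K : Y → Y → ℝ≥0∞} {N : ℝ≥0∞} (hr : ∀ y, ∑' z, K y z ≤ N)
    (hc : ∀ z, ∑' y, K y z ≤ N) (u : Y → ℝ≥0∞) :
    ∑' y, (∑' z, K y z * u z) ^ 2 ≤ N ^ 2 * ∑' z, u z ^ 2 := by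
  calc ∑' y, (∑' z, K y z * u z) ^ 2 ≤ ∑' y, N * ∑' z, K y z * u z ^ 2 := by
        refine ENNReal.tsum_le_tsum fun y => (tsum_mul_sq_le _ _).trans ?_
        gcongr
        exact hr y
    _ = N * ∑' z, (∑' y, K y z) * u z ^ 2 := by
        rw [ENNReal.tsum_mul_left, ENNReal.tsum_comm]
        simp only [ENNReal.tsum_mul_right]
    _ ≤ N * ∑' z, N * u z ^ 2 := by
        gcongr with z
        exact hc z
    _ = N ^ 2 * ∑' z, u z ^ 2 := by
        rw [ENNReal.tsum_mul_left, ← mul_assoc, sq]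

/-- Schur's test. -/
theorem exists_schur {K : Y → Y → ℂ} {N : ℝ≥0∞} (hN : N < ∞) (hr : ∀ y, ∑' z, ‖K y z‖ₑ ≤ N)
    (hc : ∀ z, ∑' y, ‖K y z‖ₑ ≤ N) :
    ∃ T : L2 Y →L[ℂ] L2 Y, (∀ ξ y, T ξ y = ∑' z, K y z * ξ z) ∧ ‖T‖ₑ ≤ N := by
  have hb : ∀ ξ : L2 Y, ∑' y, (∑' z, ‖K y z * ξ z‖ₑ) ^ 2 ≤ (N * ‖ξ‖ₑ) ^ 2 := by
    intro ξ
    simp only [enorm_mul]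
    refine (tsum_sq_tsum_mul_le hr hc _).trans ?_
    rw [tsum_enorm_sq, mul_pow]
  have hfin : ∀ ξ : L2 Y, (N * ‖ξ‖ₑ) ^ 2 < ∞ := fun ξ =>
    ENNReal.pow_lt_top (ENNReal.mul_lt_top hN enorm_lt_top)
  -- Needed for additivity, as a divergent `tsum` would silently be 0.
  have hs : ∀ (ξ : L2 Y) y, Summable fun z => K y z * ξ z := by
    intro ξ y
    have h1 : (∑' z, ‖K y z * ξ z‖ₑ) ^ 2 < ∞ :=
      (ENNReal.le_tsum y).trans_lt ((hb ξ).trans_lt (hfin ξ))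
    have h2 : ∑' z, ‖K y z * ξ z‖ₑ ≠ ∞ := fun h => by rw [h] at h1; simp at h1
    refine Summable.of_norm (f := fun z => K y z * ξ z) ?_
    exact NNReal.summable_coe.2 (ENNReal.tsum_coe_ne_top_iff_summable.1 h2)
  have hb' : ∀ ξ : L2 Y, ∑' y, ‖∑' z, K y z * ξ z‖ₑ ^ 2 ≤ (N * ‖ξ‖ₑ) ^ 2 := by
    refine fun ξ => le_trans (ENNReal.tsum_le_tsum fun y => ?_) (hb ξ)
    gcongr
    exact enorm_tsum_le_tsum_enorm
  let T₀ : L2 Y →ₗ[ℂ] L2 Y :=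
    { toFun := fun ξ => ⟨fun y => ∑' z, K y z * ξ z,
        memℓp_two_of_tsum ((hb' ξ).trans_lt (hfin ξ)).ne⟩
      map_add' := by
        intro ξ η
        ext y
        simp only [lp.coeFn_add, Pi.add_apply, mul_add]
        exact (hs ξ y).tsum_add (hs η y)
      map_smul' := by
        intro c ξ
        ext y
        simp only [lp.coeFn_smul, Pi.smul_apply, smul_eq_mul, RingHom.id_apply, ← tsum_mul_left]
        exact tsum_congr fun z => by ring }
  have hT : ∀ ξ, ‖T₀ ξ‖ₑ ≤ N * ‖ξ‖ₑ := by
    intro ξ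
    have h : ‖T₀ ξ‖ₑ ^ 2 ≤ (N * ‖ξ‖ₑ) ^ 2 := by
      rw [← tsum_enorm_sq]
      exact hb' ξ
    exact (ENNReal.pow_right_strictMono two_ne_zero).le_iff_le.1 h
  have hT' : ∀ ξ, ‖T₀ ξ‖ ≤ N.toReal * ‖ξ‖ := by
    intro ξ
    have := ENNReal.toReal_mono (ENNReal.mul_lt_top hN enorm_lt_top).ne (hT ξ)
    simpa using this
  refine ⟨T₀.mkContinuous N.toReal hT', fun ξ y => rfl, ?_⟩
  have := ENNReal.ofReal_le_ofReal
    (LinearMap.mkContinuous_norm_le T₀ ENNReal.toReal_nonneg hT')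
  rwa [ofReal_norm, ENNReal.ofReal_toReal hN.ne] at this

open Classical in
/-- The matrix entries of an operator on `ℓ²(Y)`. -/
noncomputable def entry (T : L2 Y →L[ℂ] L2 Y) (y z : Y) : ℂ := T (lp.single 2 z 1) y

theorem entry_ext {S T : L2 Y →L[ℂ] L2 Y} (h : ∀ y z, entry S y z = entry T y z) : S = T := by
  classical
  refine lp.ext_continuousLinearMap (by simp) fun z => ?_
  ext y
  have := h y z
  simp only [entry] at this
  simpa using this

theorem entry_eq_of_apply {T : L2 Y →L[ℂ] L2 Y} {K : Y → Y → ℂ}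
    (h : ∀ ξ y, T ξ y = ∑' z, K y z * ξ z) (y z : Y) : entry T y z = K y z := by
  classical
  rw [entry, h, tsum_eq_single z]
  · rw [lp.single_apply_self, mul_one]
  · intro w hw
    rw [lp.single_apply_ne _ _ _ hw, mul_zero]

theorem entry_mul {S T : L2 Y →L[ℂ] L2 Y} {K : Y → Y → ℂ}
    (h : ∀ ξ y, S ξ y = ∑' z, K y z * ξ z) (y z : Y) :
    entry (S * T) y z = ∑' w, entry S y w * entry T w z := by
  have h1 : entry (S * T) y z = ∑' w, K y w * entry T w z := h _ _
  rw [h1]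
  exact tsum_congr fun w => by rw [entry_eq_of_apply h]

theorem entry_star (T : L2 Y →L[ℂ] L2 Y) (y z : Y) : entry (star T) y z = star (entry T z y) := by
  classical
  have h1 := lp.inner_single_left (𝕜 := ℂ) (G := fun _ : Y => ℂ) y 1 (star T (lp.single 2 z 1))
  have h2 := lp.inner_single_right (𝕜 := ℂ) (G := fun _ : Y => ℂ) z 1 (T (lp.single 2 y 1))
  rw [ContinuousLinearMap.star_eq_adjoint, ContinuousLinearMap.adjoint_inner_right, h2] at h1
  simp only [RCLike.inner_apply, map_one, mul_one, one_mul] at h1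
  rw [entry, entry, ContinuousLinearMap.star_eq_adjoint]
  convert! h1.symm using 1

theorem norm_entry_le (T : L2 Y →L[ℂ] L2 Y) (y z : Y) : ‖entry T y z‖ ≤ ‖T‖ := by
  classical
  refine (lp.norm_apply_le_norm (by simp) _ y).trans ((T.le_opNorm _).trans ?_)
  rw [lp.norm_single (by simp), norm_one, mul_one]

end Schur

theorem tsum_ite_of_subsingleton {α : Type*} {P : α → Prop} [DecidablePred P]
    [Decidable (∃ a, P a)] (h : ∀ a b, P a → P b → a = b) {M : Type*} [AddCommMonoid M]
    [TopologicalSpace M] (v : M) :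
    ∑' a, (if P a then v else 0) = if ∃ a, P a then v else 0 := by
  by_cases hP : ∃ a, P a
  · obtain ⟨a, ha⟩ := hP
    rw [if_pos ⟨a, ha⟩, tsum_eq_single a fun b hb => if_neg fun h' => hb (h b a h' ha), if_pos ha]
  · rw [if_neg hP]
    push Not at hP
    simp [hP]

/-! ### The cocycle on G and finiteness of fibres -/

namespace G

/-- The cocycle that counts the edges `α`. -/
def coc (a : G k) : ℤ := a.1.coc

theorem inv_inv (a : G k) : a.inv.inv = a := Subtype.ext (GLam.inv_inv a.1)

theorem exists_isProd {a b : G k} (h : a.s = b.r) : ∃ c, IsProd a b c := by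
  obtain ⟨c, hc⟩ := GLam.exists_isProd (a := a.1) (b := b.1) h
  exact ⟨⟨c, hc.r_eq ▸ a.2.1, hc.s_eq ▸ b.2.2⟩, hc⟩

/-- The support is covered by finitely many bisections, and each of them has at most one element
over x for each of the two maps. -/
theorem finite_fiber (f : C_c(G k, ℂ)) (x : DHSet k) :
    {a : G k | (a.s = x ∨ a.r = x) ∧ f a ≠ 0}.Finite := by
  obtain ⟨t, ht⟩ := IsCompact.elim_finite_subcover (s := tsupport f) f.hasCompactSupport
    (fun p : Lam k × Lam k => bis p.1 p.2 Set.univ) (fun p => isOpen_bis_univ p.1 p.2)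
    (fun a _ => by
      obtain ⟨m, n, h⟩ := mem_bis_self a
      exact Set.mem_iUnion.2 ⟨(m, n), h⟩)
  refine Set.Finite.subset (s := ⋃ p ∈ t, ({a ∈ bis p.1 p.2 Set.univ | a.s = x} ∪
    {a ∈ bis p.1 p.2 Set.univ | a.r = x})) (t.finite_toSet.biUnion fun p _ => ?_) ?_
  · refine Set.Finite.union (Set.Subsingleton.finite ?_) (Set.Subsingleton.finite ?_)
    · exact fun a ha b hb => bis_injOn p.1 p.2 a b ha.1 hb.1 (.inl (ha.2.trans hb.2.symm))
    · exact fun a ha b hb => bis_injOn p.1 p.2 a b ha.1 hb.1 (.inr (ha.2.trans hb.2.symm))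
  · rintro a ⟨ha, hf⟩
    obtain ⟨p, hp, hap⟩ := Set.mem_iUnion₂.1 (ht (subset_tsupport f hf))
    exact Set.mem_iUnion₂.2 ⟨p, hp, ha.imp (fun h => ⟨hap, h⟩) fun h => ⟨hap, h⟩⟩

/-! ### The representation on `ℓ²(Λ* × ℤ)` -/

/-- The groupoid element `a` maps the point `z` of `Λ* × ℤ` to `y`. -/
def Moves (a : G k) (y z : DHSet k × ℤ) : Prop := a.r = y.1 ∧ a.s = z.1 ∧ y.2 = z.2 + a.coc

theorem Moves.unique_left {a : G k} {y y' z : DHSet k × ℤ} (h : a.Moves y z) (h' : a.Moves y' z) :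
    y = y' :=
  Prod.ext (h.1.symm.trans h'.1) (h.2.2.trans h'.2.2.symm)

theorem Moves.unique_right {a : G k} {y z z' : DHSet k × ℤ} (h : a.Moves y z) (h' : a.Moves y z') :
    z = z' :=
  Prod.ext (h.2.1.symm.trans h'.2.1) (by have h1 := h.2.2; have h2 := h'.2.2; omega)

theorem moves_inv {a : G k} {y z : DHSet k × ℤ} : a.inv.Moves y z ↔ a.Moves z y := by
  have h1 : a.inv.r = a.s := GLam.r_inv a.1
  have h2 : a.inv.s = a.r := GLam.s_inv a.1
  have h3 : a.inv.coc = - a.coc := GLam.coc_inv a.1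
  simp only [Moves, h1, h2, h3]
  constructor <;> rintro ⟨h1, h2, h3⟩ <;> exact ⟨h2, h1, by omega⟩

/-- Additivity of the cocycle makes the ℤ-coordinate of the intermediate point consistent. This is
what turns convolution into the matrix product. -/
theorem exists_moves_comp {a b : G k} {y z : DHSet k × ℤ} :
    (∃ c, IsProd a b c ∧ c.Moves y z) ↔ ∃ w, a.Moves y w ∧ b.Moves w z := by
  constructor
  · rintro ⟨c, hc, h1, h2, h3⟩
    have h4 : c.coc = a.coc + b.coc := GLam.IsProd.coc_eq hc
    have h5 : c.r = a.r := GLam.IsProd.r_eq hc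
    have h6 : c.s = b.s := GLam.IsProd.s_eq hc
    have h7 : a.s = b.r := GLam.IsProd.s_eq_r hc
    exact ⟨(a.s, z.2 + b.coc), ⟨h5.symm.trans h1, rfl, by dsimp only; omega⟩,
      h7.symm, h6.symm.trans h2, rfl⟩
  · rintro ⟨w, ⟨h1, h2, h3⟩, h4, h5, h6⟩
    obtain ⟨c, hc⟩ := exists_isProd (h2.trans h4.symm)
    have h7 : c.coc = a.coc + b.coc := GLam.IsProd.coc_eq hc
    exact ⟨c, hc, (GLam.IsProd.r_eq hc).trans h1, (GLam.IsProd.s_eq hc).trans h5, by omega⟩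

open Classical in
/-- The matrix of the operator attached to the function `f`. -/
noncomputable def kernel (f : G k → ℂ) (y z : DHSet k × ℤ) : ℂ :=
  ∑' a : G k, if a.Moves y z then f a else 0

open Classical in
theorem kernel_eq_sum (f : C_c(G k, ℂ)) {y z : DHSet k × ℤ} {S : Finset (G k)}
    (hS : ∀ a, a.Moves y z → f a ≠ 0 → a ∈ S) :
    kernel f y z = ∑ a ∈ S, if a.Moves y z then f a else 0 := by
  refine tsum_eq_sum fun a ha => ?_
  by_cases h : a.Moves y z
  · rw [if_pos h]
    by_contra h'
    exact ha (hS a h h')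
  · rw [if_neg h]

theorem exists_finset_kernel_eq (f : C_c(G k, ℂ)) (x : DHSet k) :
    ∃ S : Finset (G k), ∀ a, (a.s = x ∨ a.r = x) → f a ≠ 0 → a ∈ S :=
  ⟨(finite_fiber f x).toFinset, fun _ h h' => (finite_fiber f x).mem_toFinset.2 ⟨h, h'⟩⟩

/-- Each a with r(a) = y.1 contributes to exactly one column, since the cocycle fixes the
ℤ-coordinate; so a row sum is bounded by a sum over one range fibre. -/
theorem kernel_row_le (f : G k → ℂ) (y : DHSet k × ℤ) : ∑' z, ‖kernel f y z‖ₑ ≤ iNorm f := by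
  classical
  calc ∑' z, ‖kernel f y z‖ₑ ≤ ∑' z, ∑' a : G k, if a.Moves y z then ‖f a‖ₑ else 0 := by
        refine ENNReal.tsum_le_tsum fun z => enorm_tsum_le_tsum_enorm.trans_eq ?_
        exact tsum_congr fun a => by split_ifs <;> simp
    _ = ∑' a : G k, ∑' z, if a.Moves y z then ‖f a‖ₑ else 0 := ENNReal.tsum_comm
    _ ≤ ∑' a : G k, {a : G k | a.r = y.1}.indicator (fun a => ‖f a‖ₑ) a := by
        refine ENNReal.tsum_le_tsum fun a => ?_
        rw [tsum_ite_of_subsingleton fun z z' h h' => h.unique_right h']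
        split_ifs with h
        · obtain ⟨z, hz⟩ := h
          rw [Set.indicator_of_mem (show a ∈ {a : G k | a.r = y.1} from hz.1)]
        · exact bot_le
    _ = ∑' a : {a : G k // a.r = y.1}, ‖f a.1‖ₑ :=
        (tsum_subtype {a : G k | a.r = y.1} fun a => ‖f a‖ₑ).symm
    _ ≤ iNorm f := le_max_of_le_right
        (le_iSup (fun x : DHSet k => ∑' a : {a : G k // a.r = x}, ‖f a.1‖ₑ) y.1)

theorem kernel_col_le (f : G k → ℂ) (z : DHSet k × ℤ) : ∑' y, ‖kernel f y z‖ₑ ≤ iNorm f := by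
  classical
  calc ∑' y, ‖kernel f y z‖ₑ ≤ ∑' y, ∑' a : G k, if a.Moves y z then ‖f a‖ₑ else 0 := by
        refine ENNReal.tsum_le_tsum fun z => enorm_tsum_le_tsum_enorm.trans_eq ?_
        exact tsum_congr fun a => by split_ifs <;> simp
    _ = ∑' a : G k, ∑' y, if a.Moves y z then ‖f a‖ₑ else 0 := ENNReal.tsum_comm
    _ ≤ ∑' a : G k, {a : G k | a.s = z.1}.indicator (fun a => ‖f a‖ₑ) a := by
        refine ENNReal.tsum_le_tsum fun a => ?_
        rw [tsum_ite_of_subsingleton fun z z' h h' => h.unique_left h']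
        split_ifs with h
        · obtain ⟨y, hy⟩ := h
          rw [Set.indicator_of_mem (show a ∈ {a : G k | a.s = z.1} from hy.2.1)]
        · exact bot_le
    _ = ∑' a : {a : G k // a.s = z.1}, ‖f a.1‖ₑ :=
        (tsum_subtype {a : G k | a.s = z.1} fun a => ‖f a‖ₑ).symm
    _ ≤ iNorm f := le_max_of_le_left
        (le_iSup (fun x : DHSet k => ∑' a : {a : G k // a.s = x}, ‖f a.1‖ₑ) z.1)

theorem kernel_add (f g : C_c(G k, ℂ)) (y z : DHSet k × ℤ) :
    kernel (f + g : C_c(G k, ℂ)) y z = kernel f y z + kernel g y z := by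
  classical
  obtain ⟨S, hS⟩ := exists_finset_kernel_eq f y.1
  obtain ⟨T, hT⟩ := exists_finset_kernel_eq g y.1
  have h1 : ∀ a ∉ S ∪ T, a.Moves y z → f a = 0 ∧ g a = 0 := by
    intro a ha h
    rw [Finset.notMem_union] at ha
    exact ⟨by_contra fun h' => ha.1 (hS a (.inr h.1) h'),
      by_contra fun h' => ha.2 (hT a (.inr h.1) h')⟩
  rw [kernel_eq_sum f (S := S ∪ T) fun a h h' => by_contra fun ha => h' (h1 a ha h).1,
    kernel_eq_sum g (S := S ∪ T) fun a h h' => by_contra fun ha => h' (h1 a ha h).2,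
    kernel_eq_sum (f + g) (S := S ∪ T) fun a h h' => by_contra fun ha => h' (by
      rw [CompactlySupportedContinuousMap.add_apply, (h1 a ha h).1, (h1 a ha h).2, add_zero]),
    ← Finset.sum_add_distrib]
  exact Finset.sum_congr rfl fun a _ => by split_ifs <;> simp

theorem kernel_smul (c : ℂ) (f : C_c(G k, ℂ)) (y z : DHSet k × ℤ) :
    kernel (c • f : C_c(G k, ℂ)) y z = c * kernel f y z := by
  rw [kernel, kernel, ← tsum_mul_left]
  exact tsum_congr fun a => by split_ifs <;> simp

theorem kernel_starFun (f : G k → ℂ) (y z : DHSet k × ℤ) :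
    kernel (starFun f) y z = star (kernel f z y) := by
  have hinv : Function.Involutive (inv : G k → G k) := inv_inv
  rw [kernel, kernel, tsum_star, ← hinv.toPerm.tsum_eq]
  refine tsum_congr fun a => ?_
  rw [Function.Involutive.coe_toPerm]
  by_cases h : a.Moves z y
  · rw [if_pos (moves_inv.2 h), if_pos h, starFun, inv_inv]
  · rw [if_neg (mt moves_inv.1 h), if_neg h, star_zero]

theorem conv_eq_sum (f g : C_c(G k, ℂ)) {c : G k} {S T : Finset (G k)}
    (hS : ∀ a, a.r = c.r → f a ≠ 0 → a ∈ S) (hT : ∀ b, b.s = c.s → g b ≠ 0 → b ∈ T) :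
    open Classical in
    conv f g c = ∑ a ∈ S, ∑ b ∈ T, if IsProd a b c then f a * g b else 0 := by
  classical
  rw [conv, ← Finset.sum_product', ← Finset.sum_filter]
  have h1 : ∀ p : {p : G k × G k // IsProd p.1 p.2 c}, f p.1.1 * g p.1.2 ≠ 0 →
      p.1 ∈ (S ×ˢ T).filter fun p => IsProd p.1 p.2 c := by
    intro p hp
    refine Finset.mem_filter.2 ⟨Finset.mem_product.2 ⟨hS _ ?_ (left_ne_zero_of_mul hp),
      hT _ ?_ (right_ne_zero_of_mul hp)⟩, p.2⟩
    · exact (GLam.IsProd.r_eq p.2).symm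
    · exact (GLam.IsProd.s_eq p.2).symm
  rw [finsum_eq_sum_of_support_subset (s := ((S ×ˢ T).filter
    fun p => IsProd p.1 p.2 c).subtype fun p => IsProd p.1 p.2 c) _ ?_]
  · rw [Finset.sum_subtype_eq_sum_filter (f := fun p : G k × G k => f p.1 * g p.2),
      Finset.filter_filter]
    simp
  · intro p hp
    exact Finset.mem_coe.2 (Finset.mem_subtype.2 (h1 p hp))

/-- Both sides are finite sums of f(a)g(b) over pairs: on the left the product c = ab is unique, on
the right the intermediate point w is, and `exists_moves_comp` matches their existence. -/
theorem kernel_conv {f g h : C_c(G k, ℂ)} (hh : (h : G k → ℂ) = conv f g) (y z : DHSet k × ℤ) :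
    kernel h y z = ∑' w, kernel f y w * kernel g w z := by
  classical
  obtain ⟨S, hS⟩ := exists_finset_kernel_eq f y.1
  obtain ⟨T, hT⟩ := exists_finset_kernel_eq g z.1
  have h1 : ∀ c : G k, (if c.Moves y z then h c else 0) = ∑ a ∈ S, ∑ b ∈ T,
      if IsProd a b c ∧ c.Moves y z then f a * g b else 0 := by
    intro c
    by_cases hc : c.Moves y z
    · rw [if_pos hc, hh, conv_eq_sum f g (fun a ha => hS a (.inr (ha.trans hc.1)))
        (fun b hb => hT b (.inl (hb.trans hc.2.1)))]
      simp [hc]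
    · simp [hc]
  have h2 : ∀ w, kernel f y w * kernel g w z = ∑ a ∈ S, ∑ b ∈ T,
      if a.Moves y w ∧ b.Moves w z then f a * g b else 0 := by
    intro w
    rw [kernel_eq_sum f (S := S) fun a ha => hS a (.inr ha.1),
      kernel_eq_sum g (S := T) fun a ha => hT a (.inl ha.2.1), Finset.sum_mul_sum]
    refine Finset.sum_congr rfl fun a _ => Finset.sum_congr rfl fun b _ => ?_
    by_cases h1 : a.Moves y w <;> by_cases h2 : b.Moves w z <;> simp [h1, h2]
  have u1 : ∀ a b c c' : G k, IsProd a b c ∧ c.Moves y z → IsProd a b c' ∧ c'.Moves y z → c = c' :=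
    fun a b c c' hc hc' => Subtype.ext (GLam.IsProd.unique hc.1 hc'.1)
  have u2 : ∀ (a b : G k) (w w' : DHSet k × ℤ), a.Moves y w ∧ b.Moves w z →
      a.Moves y w' ∧ b.Moves w' z → w = w' := fun a b w w' hw hw' => hw.1.unique_right hw'.1
  have s1 : ∀ a b : G k, Summable fun c : G k =>
      if IsProd a b c ∧ c.Moves y z then f a * g b else 0 := fun a b =>
    summable_of_hasFiniteSupport (Set.Subsingleton.finite fun c hc c' hc' =>
      u1 a b c c' (by_contra fun h => hc (if_neg h)) (by_contra fun h => hc' (if_neg h)))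
  have s2 : ∀ a b : G k, Summable fun w =>
      if a.Moves y w ∧ b.Moves w z then f a * g b else 0 := fun a b =>
    summable_of_hasFiniteSupport (Set.Subsingleton.finite fun c hc c' hc' =>
      u2 a b c c' (by_contra fun h => hc (if_neg h)) (by_contra fun h => hc' (if_neg h)))
  rw [kernel, tsum_congr h1, tsum_congr h2,
    Summable.tsum_finsetSum fun a _ => summable_sum fun b _ => s1 a b,
    Summable.tsum_finsetSum fun a _ => summable_sum fun b _ => s2 a b]
  refine Finset.sum_congr rfl fun a _ => ?_
  rw [Summable.tsum_finsetSum fun b _ => s1 a b, Summable.tsum_finsetSum fun b _ => s2 a b]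
  refine Finset.sum_congr rfl fun b _ => ?_
  rw [tsum_ite_of_subsingleton (u1 a b), tsum_ite_of_subsingleton (u2 a b)]
  simp only [exists_moves_comp]

theorem exists_kernelOp (f : C_c(G k, ℂ)) : ∃ T : L2 (DHSet k × ℤ) →L[ℂ] L2 (DHSet k × ℤ),
    (∀ ξ y, T ξ y = ∑' z, kernel f y z * ξ z) ∧ ‖T‖ₑ ≤ iNorm f :=
  exists_schur (iNorm_lt_top f) (kernel_row_le f) (kernel_col_le f)

/-- The operator attached to `f`. -/
noncomputable def kernelOp (f : C_c(G k, ℂ)) : L2 (DHSet k × ℤ) →L[ℂ] L2 (DHSet k × ℤ) :=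
  (exists_kernelOp f).choose

theorem kernelOp_apply (f : C_c(G k, ℂ)) (ξ y) : kernelOp f ξ y = ∑' z, kernel f y z * ξ z :=
  (exists_kernelOp f).choose_spec.1 ξ y

theorem entry_kernelOp (f : C_c(G k, ℂ)) (y z) : entry (kernelOp f) y z = kernel f y z :=
  entry_eq_of_apply (kernelOp_apply f) y z

end G

open G

theorem entry_add {Y : Type*} (S T : L2 Y →L[ℂ] L2 Y) (y z : Y) :
    entry (S + T) y z = entry S y z + entry T y z := rfl

theorem entry_smul {Y : Type*} (c : ℂ) (T : L2 Y →L[ℂ] L2 Y) (y z : Y) :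
    entry (c • T) y z = c * entry T y z := rfl

/-- The representation on `ℓ²(Λ* × ℤ)` induced by the action of `G` on `Λ* × ℤ` given by the
cocycle. -/
noncomputable def cocRep (k : ℕ → ℕ) : Rep k where
  H := L2 (DHSet k × ℤ)
  toFun :=
    { toFun := kernelOp
      map_add' := fun f g => entry_ext fun y z => by
        rw [entry_add, entry_kernelOp, entry_kernelOp, entry_kernelOp, kernel_add]
      map_smul' := fun c f => entry_ext fun y z => by
        rw [RingHom.id_apply, entry_smul, entry_kernelOp, entry_kernelOp, kernel_smul] }
  map_conv := fun f g h hh => entry_ext fun y z => by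
    change entry (kernelOp h) y z = entry (kernelOp f * kernelOp g) y z
    rw [entry_mul (kernelOp_apply f)]
    simp only [entry_kernelOp]
    exact kernel_conv hh y z
  map_star := fun f h hh => entry_ext fun y z => by
    change entry (kernelOp h) y z = entry (star (kernelOp f)) y z
    rw [entry_star, entry_kernelOp, entry_kernelOp, hh, kernel_starFun]
  bounded := fun f => (exists_kernelOp f).choose_spec.2

/-- The matrix entries of the elements of `C*(G)` in the representation `cocRep`. -/
noncomputable def coeff (y z : DHSet k × ℤ) : CStarG k →L[ℂ] ℂ :=
  LinearMap.mkContinuous (𝕜 := ℂ) (E := CStarG k) (F := ℂ)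
    { toFun := fun a => entry (a.1 (cocRep k)) y z
      map_add' := fun _ _ => rfl
      map_smul' := fun _ _ => rfl } 1 fun a => by
    rw [one_mul]
    exact (norm_entry_le _ _ _).trans (lp.norm_apply_le_norm (by simp) a.1 (cocRep k))

theorem coeff_ofCc (f : C_c(G k, ℂ)) (y z : DHSet k × ℤ) : coeff y z (ofCc k f) = kernel f y z :=
  entry_kernelOp f y z

/-- The norm of C*(G) is a supremum over all representations, `cocRep` among them. -/
theorem norm_coeff_le (y z : DHSet k × ℤ) (a : CStarG k) : ‖coeff y z a‖ ≤ ‖a‖ :=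
  (norm_entry_le _ _ _).trans (lp.norm_apply_le_norm (by simp) a.1 (cocRep k))

/-! ### Products, adjoints and sums of characteristic functions -/

theorem exists_ofCc_eq_chi {S : Set (G k)} (h : IsCompact S ∧ IsClopen S) :
    ∃ f : C_c(G k, ℂ), (f : G k → ℂ) = S.indicator 1 ∧ chi k S = ofCc k f := by
  rw [chi, dif_pos h]
  exact ⟨_, rfl, rfl⟩

theorem ofCc_mul {f g h : C_c(G k, ℂ)} (hh : (h : G k → ℂ) = G.conv f g) :
    ofCc k f * ofCc k g = ofCc k h := by
  refine Subtype.ext (lp.ext (funext fun p => ?_))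
  exact (p.map_conv f g h hh).symm

theorem ofCc_star {f h : C_c(G k, ℂ)} (hh : (h : G k → ℂ) = G.starFun f) :
    star (ofCc k f) = ofCc k h := by
  refine Subtype.ext (lp.ext (funext fun p => ?_))
  exact (p.map_star f h hh).symm

theorem ofCc_add (f g : C_c(G k, ℂ)) : ofCc k (f + g) = ofCc k f + ofCc k g :=
  Subtype.ext (map_add (univRep k) f g)

theorem ofCc_zero : ofCc k 0 = 0 :=
  Subtype.ext (map_zero (univRep k))

theorem chi_empty : chi k (∅ : Set (G k)) = 0 := by
  obtain ⟨f, hf, h⟩ := exists_ofCc_eq_chi (S := (∅ : Set (G k))) ⟨isCompact_empty, isClopen_empty⟩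
  rw [h, ← ofCc_zero]
  congr 1
  ext a
  rw [hf]
  simp

theorem chi_union {S T : Set (G k)} (hS : IsCompact S ∧ IsClopen S) (hT : IsCompact T ∧ IsClopen T)
    (h : Disjoint S T) : chi k (S ∪ T) = chi k S + chi k T := by
  obtain ⟨f, hf, h1⟩ := exists_ofCc_eq_chi hS
  obtain ⟨g, hg, h2⟩ := exists_ofCc_eq_chi hT
  obtain ⟨u, hu, h3⟩ := exists_ofCc_eq_chi (S := S ∪ T) ⟨hS.1.union hT.1, hS.2.union hT.2⟩
  rw [h1, h2, h3, ← ofCc_add]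
  congr 1
  ext a
  rw [hu, Set.indicator_union_of_disjoint h, CompactlySupportedContinuousMap.add_apply, hf, hg]

theorem chi_biUnion_mem {ι : Type*} (J : Finset ι) {S : ι → Set (G k)}
    (hS : ∀ j, IsCompact (S j) ∧ IsClopen (S j)) (hd : Pairwise (Function.onFun Disjoint S))
    (V : Submodule ℂ (CStarG k)) (hV : ∀ j, chi k (S j) ∈ V) : chi k (⋃ j ∈ J, S j) ∈ V := by
  classical
  induction J using Finset.induction_on with
  | empty => simp [chi_empty]
  | insert j J hj ih =>
    rw [Finset.set_biUnion_insert, chi_union (hS j)]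
    · exact V.add_mem (hV j) ih
    · exact ⟨J.isCompact_biUnion fun i _ => (hS i).1,
        J.finite_toSet.isClopen_biUnion fun i _ => (hS i).2⟩
    · refine Set.disjoint_iUnion₂_right.2 fun i hi => hd ?_
      rintro rfl
      exact hj hi

namespace G

/-- In c = ab the range of a and the source of b are those of c, so injectivity of r on S and of s
on T leaves at most one factorization. -/
theorem conv_indicator {S T U : Set (G k)} (hS : ∀ a ∈ S, ∀ b ∈ S, a.r = b.r → a = b)
    (hT : ∀ a ∈ T, ∀ b ∈ T, a.s = b.s → a = b)
    (hU : ∀ c, c ∈ U ↔ ∃ a ∈ S, ∃ b ∈ T, IsProd a b c) :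
    conv (S.indicator 1) (T.indicator 1) = U.indicator 1 := by
  funext c
  by_cases hc : c ∈ U
  · obtain ⟨a, ha, b, hb, hab⟩ := (hU c).1 hc
    rw [conv, finsum_eq_single _ ⟨(a, b), hab⟩]
    · simp [ha, hb, hc]
    · rintro ⟨⟨a', b'⟩, hab'⟩ hne
      by_contra h
      have ha' : a' ∈ S := by
        by_contra h'
        exact h (by simp [h'])
      have hb' : b' ∈ T := by
        by_contra h'
        exact h (by simp [h'])
      refine hne (Subtype.ext (Prod.ext (hS a' ha' a ha ?_) (hT b' hb' b hb ?_)))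
      · exact (GLam.IsProd.r_eq hab').symm.trans (GLam.IsProd.r_eq hab)
      · exact (GLam.IsProd.s_eq hab').symm.trans (GLam.IsProd.s_eq hab)
  · rw [conv, Set.indicator_of_notMem hc]
    refine finsum_eq_zero_of_forall_eq_zero ?_
    rintro ⟨⟨a, b⟩, hab⟩
    by_contra h
    refine hc ((hU c).2 ⟨a, ?_, b, ?_, hab⟩) <;> by_contra h' <;> exact h (by simp [h'])

theorem mem_bis_of_mem {m n : Lam k} {E : Set (DHSet k)} {a : G k} (h : a ∈ bis m n E) :
    a ∈ bis m n Set.univ := by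
  obtain ⟨x, hm, hn, -, e⟩ := h
  exact ⟨x, hm, hn, trivial, e⟩

theorem inv_mem_bis {m n : Lam k} {E : Set (DHSet k)} {a : G k} :
    a.inv ∈ bis m n E ↔ a ∈ bis n m E := by
  have key : ∀ (m n : Lam k) (a : G k), a ∈ bis n m E → a.inv ∈ bis m n E := by
    rintro m n ⟨a, ha⟩ ⟨x, h1, h2, h3, rfl⟩
    exact ⟨x, h2, h1, h3, rfl⟩
  refine ⟨fun h => ?_, key m n a⟩
  have := key n m _ h
  rwa [inv_inv] at this

theorem bis_comp {m n e : Lam k} (hm : m.src = e.rng) (hn : n.src = e.rng) {A B : Set (DHSet k)}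
    (h : ∀ y (hy : y.HasRange e.src), act e y hy ∈ A ↔ y ∈ B) (hA : A ⊆ Z e) :
    bis (m.comp e hm) (n.comp e hn) B = bis m n A := by
  ext ⟨a, ha⟩
  constructor
  · rintro ⟨y, h1, h2, h3, rfl⟩
    have hy : y.HasRange e.src := by rwa [src_comp] at h1
    exact ⟨act e y hy, hm ▸ hy.act, hn ▸ hy.act, (h y hy).2 h3, (GLam.cls_act hy _ _ hm hn _ _).symm⟩
  · rintro ⟨x, h1, h2, h3, rfl⟩
    obtain ⟨y, hy, rfl⟩ := exists_eq_act (hA h3)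
    exact ⟨y, by rwa [src_comp], by rwa [src_comp], (h y hy).1 h3, GLam.cls_act hy _ _ hm hn _ _⟩

theorem bis_comp_Z_unit {m n e : Lam k} (hm : m.src = e.rng) (hn : n.src = e.rng) :
    bis (m.comp e hm) (n.comp e hn) (Z (unit k e.src)) = bis m n (Z e) :=
  bis_comp hm hn (fun y hy => ⟨fun _ => unit_mem_iff.2 hy, fun _ => self_mem_act e y hy⟩) subset_rfl

/-- Restricting the groupoid to X leaves only boundary points x in [m, n, x]. -/
theorem bis_congr {m n : Lam k} (hm : m.rng = 0) {A B : Set (DHSet k)}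
    (h : ∀ x ∈ boundary k, x.HasRange m.src → (x ∈ A ↔ x ∈ B)) : bis m n A = bis m n B := by
  ext ⟨a, ha⟩
  constructor <;> rintro ⟨x, h1, h2, h3, rfl⟩ <;> refine ⟨x, h1, h2, ?_, rfl⟩
  · exact (h x ((act_mem_X hm h1).1 ha.1) h1).1 h3
  · exact (h x ((act_mem_X hm h1).1 ha.1) h1).2 h3

theorem bis_union (m n : Lam k) (A B : Set (DHSet k)) : bis m n (A ∪ B) = bis m n A ∪ bis m n B := by
  ext a
  constructor
  · rintro ⟨x, h1, h2, h3 | h3, e⟩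
    · exact .inl ⟨x, h1, h2, h3, e⟩
    · exact .inr ⟨x, h1, h2, h3, e⟩
  · rintro (⟨x, h1, h2, h3, e⟩ | ⟨x, h1, h2, h3, e⟩)
    · exact ⟨x, h1, h2, .inl h3, e⟩
    · exact ⟨x, h1, h2, .inr h3, e⟩

theorem bis_biUnion (m n : Lam k) {ι : Type*} (J : Finset ι) (A : ι → Set (DHSet k)) :
    bis m n (⋃ j ∈ J, A j) = ⋃ j ∈ J, bis m n (A j) := by
  ext a
  simp only [Set.mem_iUnion]
  constructor
  · rintro ⟨x, h1, h2, h3, e⟩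
    obtain ⟨j, hj, h4⟩ := Set.mem_iUnion₂.1 h3
    exact ⟨j, hj, x, h1, h2, h4, e⟩
  · rintro ⟨j, hj, x, h1, h2, h3, e⟩
    exact ⟨x, h1, h2, Set.mem_iUnion₂.2 ⟨j, hj, h3⟩, e⟩

theorem disjoint_bis (m n : Lam k) {A B : Set (DHSet k)} (h : Disjoint A B) :
    Disjoint (bis m n A) (bis m n B) := by
  rw [Set.disjoint_left]
  rintro ⟨a, ha⟩ ⟨x, h1, h2, h3, rfl⟩ ⟨y, h4, h5, h6, e⟩
  have e' : act m x h1 = act m y h4 := congrArg GLam.r e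
  obtain rfl := act_injective m x y h1 h4 e'
  exact Set.disjoint_left.1 h h3 h6

end G

open G

theorem star_chi_bis {m n : Lam k} (hm : m.rng = 0) (hn : n.rng = 0) {A : Set (DHSet k)}
    (hA : IsClopen A) : star (chi k (G.bis m n A)) = chi k (G.bis n m A) := by
  obtain ⟨f, hf, h1⟩ := exists_ofCc_eq_chi (isCompact_isClopen_bis hm hn hA)
  obtain ⟨g, hg, h2⟩ := exists_ofCc_eq_chi (isCompact_isClopen_bis hn hm hA)
  rw [h1, h2]
  refine ofCc_star ?_
  funext a
  rw [hf, hg, starFun]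
  by_cases h : a ∈ G.bis n m A
  · simp [h, inv_mem_bis.2 h]
  · simp [h, mt inv_mem_bis.1 h]

theorem chi_bis_mul {m n m' n' l l' : Lam k} (hm : m.rng = 0) (hn : n.rng = 0) (hm' : m'.rng = 0)
    (hn' : n'.rng = 0) (hl : l.rng = 0) (hl' : l'.rng = 0) {A A' B : Set (DHSet k)}
    (hA : IsClopen A) (hA' : IsClopen A') (hB : IsClopen B)
    (hU : ∀ c, c ∈ G.bis l l' B ↔ ∃ a ∈ G.bis m n A, ∃ b ∈ G.bis m' n' A', G.IsProd a b c) :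
    chi k (G.bis m n A) * chi k (G.bis m' n' A') = chi k (G.bis l l' B) := by
  obtain ⟨f, hf, h1⟩ := exists_ofCc_eq_chi (isCompact_isClopen_bis hm hn hA)
  obtain ⟨g, hg, h2⟩ := exists_ofCc_eq_chi (isCompact_isClopen_bis hm' hn' hA')
  obtain ⟨u, hu, h3⟩ := exists_ofCc_eq_chi (isCompact_isClopen_bis hl hl' hB)
  rw [h1, h2, h3]
  refine ofCc_mul ?_
  rw [hf, hg, hu]
  exact (conv_indicator
    (fun a ha b hb h => bis_injOn _ _ a b (mem_bis_of_mem ha) (mem_bis_of_mem hb) (.inr h))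
    (fun a ha b hb h => bis_injOn _ _ a b (mem_bis_of_mem ha) (mem_bis_of_mem hb) (.inl h)) hU).symm

theorem chi_bis_mul_same {m n l : Lam k} (hm : m.rng = 0) (hn : n.rng = 0) (hl : l.rng = 0)
    (hmn : m.src = n.src) {A : Set (DHSet k)} (hA : IsClopen A) :
    chi k (G.bis m n A) * chi k (G.bis n l A) = chi k (G.bis m l A) := by
  refine chi_bis_mul hm hn hn hl hm hl hA hA hA ?_
  rintro ⟨c, hc⟩
  constructor
  · rintro ⟨x, h1, h2, h3, rfl⟩
    have hx : x ∈ boundary k := (act_mem_X hm h1).1 hc.1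
    have h4 : x.HasRange n.src := hmn ▸ h1
    exact ⟨⟨GLam.cls ⟨m, n, x, h1, h4⟩, hc.1, (act_mem_X hn h4).2 hx⟩, ⟨x, h1, h4, h3, rfl⟩,
      ⟨GLam.cls ⟨n, l, x, h4, h2⟩, (act_mem_X hn h4).2 hx, hc.2⟩, ⟨x, h4, h2, h3, rfl⟩,
      m, n, l, x, h1, h4, h2, rfl, rfl, rfl⟩
  · rintro ⟨⟨a, ha⟩, ⟨x, h1, h2, h3, rfl⟩, ⟨b, hb⟩, ⟨y, h4, h5, h6, rfl⟩, hab⟩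
    have e : act n x h2 = act n y h4 := GLam.IsProd.s_eq_r hab
    obtain rfl := act_injective n x y h2 h4 e
    exact ⟨x, h1, h5, h3, GLam.IsProd.unique hab ⟨m, n, l, x, h1, h2, h5, rfl, rfl, rfl⟩⟩

theorem chi_bis_mul_disjoint {m n m' n' : Lam k} (hm : m.rng = 0) (hn : n.rng = 0)
    (hm' : m'.rng = 0) (hn' : n'.rng = 0) {A A' : Set (DHSet k)} (hA : IsClopen A)
    (hA' : IsClopen A') (h : ∀ x ∈ A, ∀ y ∈ A', ∀ (hx : x.HasRange n.src) (hy : y.HasRange m'.src),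
      act n x hx ≠ act m' y hy) :
    chi k (G.bis m n A) * chi k (G.bis m' n' A') = 0 := by
  -- The zero product is presented as the bisection [m, n, ∅] so that `chi_bis_mul` applies.
  have hE : G.bis m n (∅ : Set (DHSet k)) = ∅ :=
    Set.eq_empty_of_forall_notMem fun a ⟨x, _, _, h3, _⟩ => h3
  rw [chi_bis_mul hm hn hm' hn' hm hn hA hA' isClopen_empty, hE, chi_empty]
  intro c
  rw [hE]
  refine ⟨fun h => h.elim, ?_⟩
  rintro ⟨⟨a, ha⟩, ⟨x, h1, h2, h3, rfl⟩, ⟨b, hb⟩, ⟨y, h4, h5, h6, rfl⟩, hab⟩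
  exact h x h3 y h6 h2 h4 (GLam.IsProd.s_eq_r hab)

/-- Adjoining 0 to s gives a multiplicative semigroup closed under star, and 0 does not enlarge the
span. -/
theorem adjoin_eq_span_of_mul_mem {A : Type*} [NonUnitalCStarAlgebra A] {s : Set A}
    (hmul : ∀ a ∈ s, ∀ b ∈ s, a * b ∈ s ∨ a * b = 0) (hstar : ∀ a ∈ s, star a ∈ s) :
    (NonUnitalStarAlgebra.adjoin ℂ s : Set A) = Submodule.span ℂ s := by
  have h1 : s ∪ star s = s := Set.union_eq_left.2 fun a ha => by
    have := hstar _ ha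
    rwa [star_star] at this
  let M : Subsemigroup A :=
    { carrier := insert 0 s
      mul_mem' := by
        rintro a b (rfl | ha) (rfl | hb)
        · simp
        · simp
        · simp
        · exact (hmul a ha b hb).symm }
  have h2 : Subsemigroup.closure s ≤ M := Subsemigroup.closure_le.2 (Set.subset_insert 0 s)
  have h3 : Submodule.span ℂ (Subsemigroup.closure s : Set A) = Submodule.span ℂ s := by
    refine le_antisymm ?_ (Submodule.span_mono Subsemigroup.subset_closure)
    rw [← Submodule.span_insert_zero (s := s)]
    exact Submodule.span_mono h2
  have h4 := NonUnitalStarAlgebra.adjoin_eq_span (R := ℂ) s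
  rw [h1, h3] at h4
  rw [← h4]
  rfl

/-! ### Words with a tail of edges β, and their common extensions -/

namespace NWord

/-- The word ends in an edge `β` and all its edges after the last `γ` are `β`. -/
def BetaTail : NWord → Prop
  | flat p q => p = 0 ∧ 1 ≤ q
  | cut _ _ _ w => BetaTail w

theorem BetaTail.one_le_len {u : NWord} (h : BetaTail u) : 1 ≤ u.len := by
  cases u with
  | flat p q => simp only [BetaTail, len] at *; omega
  | cut => simp only [len]; omega

theorem BetaTail.mul_left {v : NWord} (u : NWord) {p q j : ℕ} {w : NWord}
    (hv : v = cut p q j w) (h : BetaTail v) : BetaTail (mul u v) := by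
  subst hv
  induction u with
  | flat => exact h
  | cut _ _ _ _ ih => exact ih

theorem BetaTail.mul_beta {u : NWord} (h : BetaTail u) : BetaTail (mul u (flat 0 1)) := by
  induction u with
  | flat p q => simp only [mul, BetaTail] at *; omega
  | cut _ _ _ _ ih => exact ih h

theorem betaTail_mul_flat {e : NWord} {q : ℕ} (hq : 1 ≤ q)
    (he : e = flat 0 0 ∨ ∃ u j, e = mul u (cut 0 0 j (flat 0 0))) :
    BetaTail (mul e (flat 0 q)) := by
  obtain rfl | ⟨u, j, rfl⟩ := he
  · simpa [mul, BetaTail] using hq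
  · rw [mul_assoc']
    exact BetaTail.mul_left u rfl (by simpa [mul, BetaTail] using hq)

theorem BetaTail.exists_eq {v : NWord} (h : BetaTail v) : ∃ e q, v = mul e (flat 0 q) ∧ 1 ≤ q ∧
    (e = flat 0 0 ∨ ∃ u j, e = mul u (cut 0 0 j (flat 0 0))) := by
  induction v with
  | flat p q =>
    obtain ⟨rfl, hq⟩ := h
    exact ⟨flat 0 0, q, by simp [mul], hq, .inl rfl⟩
  | cut p q j w ih =>
    obtain ⟨e, r, rfl, hr, he⟩ := ih h
    refine ⟨cut p q j e, r, rfl, hr, .inr ?_⟩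
    obtain rfl | ⟨u, j', rfl⟩ := he
    · exact ⟨flat p q, j, by simp [mul]⟩
    · exact ⟨cut p q j u, j', rfl⟩

/-- The words can differ only in their last flat block; having the same length, one of them has
fewer β there than the other, hence fewer than w, and can be prolonged by β inside w. -/
theorem pre_beta_of_len_eq {u v w : NWord} (hu : Pre u w) (hv : Pre v w) (hl : u.len = v.len)
    (hne : u ≠ v) : Pre (mul u (flat 0 1)) w ∨ Pre (mul v (flat 0 1)) w := by
  induction u generalizing v w with
  | flat p q =>
    cases v with
    | flat p' q' =>
      have : ¬ (p = p' ∧ q = q') := by rintro ⟨rfl, rfl⟩; exact hne rfl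
      cases w <;> simp only [mul, flat_pre_flat, flat_pre_cut, len] at * <;> omega
    | cut p' q' j t =>
      cases w with
      | flat => exact absurd hv not_cut_pre_flat
      | cut =>
        simp only [flat_pre_cut, cut_pre_cut, len] at *
        omega
  | cut p q j t ih =>
    cases w with
    | flat => exact absurd hu not_cut_pre_flat
    | cut a b c w =>
      cases v with
      | flat p' q' =>
        simp only [flat_pre_cut, cut_pre_cut, len] at *
        omega
      | cut p' q' j' t' =>
        rw [cut_pre_cut] at hu hv
        obtain ⟨rfl, rfl, rfl, hu⟩ := hu
        obtain ⟨rfl, rfl, rfl, hv⟩ := hv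
        simp only [mul, cut_pre_cut, true_and]
        refine ih hu hv ?_ ?_
        · simp only [len] at hl; omega
        · rintro rfl; exact hne rfl

/-- In the decisive case the last blocks are α^p β^q for u and β^{p+q+1} for v, so w has room for
one more β after u. A further γ in v would have a β behind it and make v too long. -/
theorem pre_beta_of_betaTail {u v w : NWord} (hu : Pre u w) (hv : Pre v w)
    (hl : v.len = u.len + 1) (h : BetaTail v) : Pre (mul u (flat 0 1)) w := by
  induction u generalizing v w with
  | flat p q =>
    cases v with
    | flat p' q' =>
      cases w <;> simp only [mul, flat_pre_flat, flat_pre_cut, len, BetaTail] at * <;> omega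
    | cut p' q' j t =>
      cases w with
      | flat => exact absurd hv not_cut_pre_flat
      | cut =>
        have := BetaTail.one_le_len (u := t) h
        simp only [flat_pre_cut, cut_pre_cut, len] at *
        omega
  | cut p q j t ih =>
    cases w with
    | flat => exact absurd hu not_cut_pre_flat
    | cut a b c w =>
      cases v with
      | flat p' q' =>
        simp only [flat_pre_cut, cut_pre_cut, len, BetaTail] at *
        omega
      | cut p' q' j' t' =>
        rw [cut_pre_cut] at hu hv
        obtain ⟨rfl, rfl, rfl, hu⟩ := hu
        obtain ⟨rfl, rfl, rfl, hv⟩ := hv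
        simp only [mul, cut_pre_cut, true_and]
        exact ih hu hv (by simp only [len] at hl; omega) h

theorem BetaTail.eq_of_len_eq {u v w : NWord} (hu : Pre u w) (hv : Pre v w) (hl : u.len = v.len)
    (h : BetaTail u) (h' : BetaTail v) : u = v := by
  induction u generalizing v w with
  | flat p q =>
    cases v with
    | flat p' q' =>
      simp only [len, BetaTail] at *
      rw [h.1, h'.1, show q = q' by omega]
    | cut p' q' j t =>
      cases w with
      | flat => exact absurd hv not_cut_pre_flat
      | cut =>
        simp only [flat_pre_cut, cut_pre_cut, len, BetaTail] at *
        omega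
  | cut p q j t ih =>
    cases w with
    | flat => exact absurd hu not_cut_pre_flat
    | cut a b c w =>
      cases v with
      | flat p' q' =>
        simp only [flat_pre_cut, cut_pre_cut, len, BetaTail] at *
        omega
      | cut p' q' j' t' =>
        rw [cut_pre_cut] at hu hv
        obtain ⟨rfl, rfl, rfl, hu⟩ := hu
        obtain ⟨rfl, rfl, rfl, hv⟩ := hv
        rw [ih hu hv (by simp only [len] at hl; omega) h h']

theorem finite_valid (k : ℕ → ℕ) (L : ℕ) : ∀ n, {w : NWord | Valid k n w ∧ w.len < L}.Finite := by
  induction L with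
  | zero => simp
  | succ L ih =>
    intro n
    refine Set.Finite.subset (s := Set.image2 flat (Set.Iio (L + 1)) (Set.Iio (L + 1)) ∪
      ⋃ p ∈ Set.Iio (L + 1), ⋃ q ∈ Set.Iio (L + 1), ⋃ j ∈ Set.Iio (k (n + p + q)),
        cut p q j '' {w : NWord | Valid k (n + p + q + 1) w ∧ w.len < L}) ?_ ?_
    · refine ((Set.finite_Iio _).image2 _ (Set.finite_Iio _)).union ?_
      exact (Set.finite_Iio _).biUnion fun p _ => (Set.finite_Iio _).biUnion fun q _ =>
        (Set.finite_Iio _).biUnion fun j _ => (ih _).image _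
    · rintro (⟨p, q⟩ | ⟨p, q, j, w⟩) ⟨h, hl⟩
      · simp only [len] at hl
        exact .inl ⟨p, by simp only [Set.mem_Iio]; omega, q, by simp only [Set.mem_Iio]; omega, rfl⟩
      · simp only [len] at hl
        refine .inr ?_
        simp only [Set.mem_iUnion]
        exact ⟨p, by simp only [Set.mem_Iio]; omega, q, by simp only [Set.mem_Iio]; omega, j,
          h.1, w, ⟨h.2, by omega⟩, rfl⟩

end NWord

/-! ### The generators -/

/-- As |η| ≤ i, the exponent q is at least 1; conversely η is found by stripping the final block of
β, back to the last γ or to the unit. -/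
theorem mem_setF {i : ℕ} {m : Lam k} :
    m ∈ setF k i ↔ m.rng = 0 ∧ m.len = i + 1 ∧ BetaTail m.word := by
  constructor
  · rintro ⟨e, ⟨h1, h2, h3⟩, q, hq, rfl⟩
    refine ⟨h1, ?_, betaTail_mul_flat (by omega) ?_⟩
    · refine (NWord.len_mul e.word (flat 0 q)).trans ?_
      rw [← hq, NWord.len, Nat.zero_add]
      rfl
    · obtain rfl | ⟨m, n, j, hj, h, rfl⟩ := h3
      · exact .inl rfl
      · exact .inr ⟨m.word, j, rfl⟩
  · rintro ⟨h1, h2, h3⟩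
    obtain ⟨e, q, h4, h5, h6⟩ := h3.exists_eq
    have hv := m.valid
    have h7 : e.len + q = i + 1 := by
      rw [← h2, Lam.len, h4, len_mul, NWord.len, Nat.zero_add]
    rw [h4, h1] at hv
    refine ⟨⟨0, e, (valid_of_mul hv).1⟩, ⟨rfl, ?_, ?_⟩, q, h7, Lam.ext h1 h4⟩
    · change e.len ≤ i
      omega
    · obtain rfl | ⟨u, j, rfl⟩ := h6
      · exact .inl rfl
      · have hv' := valid_of_mul (valid_of_mul hv).1
        exact .inr ⟨⟨0, u, hv'.1⟩, 0 + u.len, j, hv'.2.1, rfl, rfl⟩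

theorem src_of_mem_setE {i : ℕ} {m : Lam k} (h : m ∈ setE k i) : m.src = i := by
  rw [src, h.1, h.2, Nat.zero_add]

theorem setF_subset_setE (k : ℕ → ℕ) (i : ℕ) : setF k i ⊆ setE k (i + 1) :=
  fun _ hm => ⟨(mem_setF.1 hm).1, (mem_setF.1 hm).2.1⟩

theorem finite_setE (k : ℕ → ℕ) (i : ℕ) : (setE k i).Finite := by
  refine Set.Finite.of_finite_image (f := Lam.word) ((finite_valid k (i + 1) 0).subset ?_) ?_
  · rintro _ ⟨m, hm, rfl⟩
    have hv := m.valid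
    rw [hm.1] at hv
    exact ⟨hv, Nat.lt_succ_of_le (le_of_eq hm.2)⟩
  · exact fun m hm n hn h => Lam.ext (hm.1.trans hn.1.symm) h

theorem finite_genSets (k : ℕ → ℕ) (i : ℕ) : (genSets k i).Finite := by
  have hF := (finite_setE k (i + 1)).subset (setF_subset_setE k i)
  refine Set.Finite.union
    (((finite_setE k i).image2 (fun m n => G.bis n m (Z (beta k i))ᶜ) (finite_setE k i)).subset ?_)
    ((hF.image2 (fun m n => G.bis n m (Z (unit k (i + 1)))) hF).subset ?_)
  all_goals
    rintro _ ⟨m, hm, n, hn, rfl⟩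
    exact ⟨m, hm, n, hn, rfl⟩

theorem isCompact_isClopen_of_mem_genSets {i : ℕ} {S : Set (G k)} (hS : S ∈ genSets k i) :
    IsCompact S ∧ IsClopen S := by
  obtain ⟨m, hm, n, hn, rfl⟩ | ⟨m, hm, n, hn, rfl⟩ := hS
  · exact G.isCompact_isClopen_bis hn.1 hm.1 (isClopen_Z _).compl
  · exact G.isCompact_isClopen_bis (mem_setF.1 hn).1 (mem_setF.1 hm).1 (isClopen_Z _)

theorem beta_mem_of_pre {m : Lam k} {x : DHSet k} {hx : x.HasRange m.src} {w : Lam k}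
    (hw : w ∈ (act m x hx).carrier) (h : Pre (mul m.word (flat 0 1)) w.word) :
    beta k m.src ∈ x.carrier := by
  refine (comp_mem_act (m := m) (n := beta k m.src) rfl hx).1 ?_
  exact (act m x hx).hereditary w hw _ (isPrefix_iff.2 ⟨(hx.act w hw).symm, h⟩)

theorem exists_mem_pre {m n : Lam k} {x y : DHSet k} {hx : x.HasRange m.src}
    {hy : y.HasRange n.src} (e : act m x hx = act n y hy) :
    ∃ w ∈ (act m x hx).carrier, Pre m.word w.word ∧ Pre n.word w.word := by
  obtain ⟨w, hw, h1, h2⟩ := (act m x hx).directed _ (self_mem_act m x hx) n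
    (e ▸ self_mem_act n y hy)
  exact ⟨w, hw, (isPrefix_iff.1 h1).2, (isPrefix_iff.1 h2).2⟩

/-- For different m and n, a common extension would put β into x or into y, which is why the
generators are cut down to Z(β)ᶜ. -/
theorem eq_of_act_eq_of_mem_setE {i : ℕ} {m n : Lam k} (hm : m ∈ setE k i) (hn : n ∈ setE k i)
    {x y : DHSet k} (hx : x.HasRange m.src) (hy : y.HasRange n.src)
    (hxb : x ∈ (Z (beta k i))ᶜ) (hyb : y ∈ (Z (beta k i))ᶜ) (e : act m x hx = act n y hy) :
    m = n := by
  by_contra hne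
  obtain ⟨w, hw, h1, h2⟩ := exists_mem_pre e
  obtain h | h := pre_beta_of_len_eq h1 h2 (hm.2.trans hn.2.symm)
    fun h => hne (Lam.ext (hm.1.trans hn.1.symm) h)
  · exact hxb (src_of_mem_setE hm ▸ beta_mem_of_pre hw h)
  · exact hyb (src_of_mem_setE hn ▸ beta_mem_of_pre (e ▸ hw) h)

theorem act_ne_act_of_mem_setE_of_mem_setF {i : ℕ} {m n : Lam k} (hm : m ∈ setE k i)
    (hn : n ∈ setF k i) {x y : DHSet k} (hx : x.HasRange m.src) (hy : y.HasRange n.src)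
    (hxb : x ∈ (Z (beta k i))ᶜ) : act m x hx ≠ act n y hy := by
  intro e
  obtain ⟨w, hw, h1, h2⟩ := exists_mem_pre e
  obtain ⟨h3, h4, h5⟩ := mem_setF.1 hn
  have h6 : n.word.len = m.word.len + 1 := h4.trans (congrArg (· + 1) hm.2.symm)
  exact hxb (src_of_mem_setE hm ▸ beta_mem_of_pre hw (pre_beta_of_betaTail h1 h2 h6 h5))

theorem eq_of_act_eq_of_mem_setF {i : ℕ} {m n : Lam k} (hm : m ∈ setF k i) (hn : n ∈ setF k i)
    {x y : DHSet k} (hx : x.HasRange m.src) (hy : y.HasRange n.src)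
    (e : act m x hx = act n y hy) : m = n := by
  obtain ⟨w, hw, h1, h2⟩ := exists_mem_pre e
  obtain ⟨h3, h4, h5⟩ := mem_setF.1 hm
  obtain ⟨h6, h7, h8⟩ := mem_setF.1 hn
  exact Lam.ext (h3.trans h6.symm) (BetaTail.eq_of_len_eq h1 h2 (h4.trans h7.symm) h5 h8)

theorem star_chi_mem {i : ℕ} : ∀ a ∈ chi k '' genSets k i, star a ∈ chi k '' genSets k i := by
  rintro _ ⟨_, ⟨m, hm, n, hn, rfl⟩ | ⟨m, hm, n, hn, rfl⟩, rfl⟩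
  · rw [star_chi_bis hn.1 hm.1 (isClopen_Z _).compl]
    exact ⟨_, .inl ⟨n, hn, m, hm, rfl⟩, rfl⟩
  · rw [star_chi_bis (mem_setF.1 hn).1 (mem_setF.1 hm).1 (isClopen_Z _)]
    exact ⟨_, .inr ⟨n, hn, m, hm, rfl⟩, rfl⟩

theorem chi_mul_mem {i : ℕ} : ∀ a ∈ chi k '' genSets k i, ∀ b ∈ chi k '' genSets k i,
    a * b ∈ chi k '' genSets k i ∨ a * b = 0 := by
  rintro _ ⟨_, ⟨m, hm, n, hn, rfl⟩ | ⟨m, hm, n, hn, rfl⟩, rfl⟩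
    _ ⟨_, ⟨m', hm', n', hn', rfl⟩ | ⟨m', hm', n', hn', rfl⟩, rfl⟩
  · by_cases h : m = n'
    · subst h
      rw [chi_bis_mul_same hn.1 hm.1 hm'.1
        ((src_of_mem_setE hn).trans (src_of_mem_setE hm).symm) (isClopen_Z _).compl]
      exact .inl ⟨_, .inl ⟨m', hm', n, hn, rfl⟩, rfl⟩
    · refine .inr (chi_bis_mul_disjoint hn.1 hm.1 hn'.1 hm'.1 (isClopen_Z _).compl
        (isClopen_Z _).compl fun x hx y hy h1 h2 e => h ?_)
      exact eq_of_act_eq_of_mem_setE hm hn' h1 h2 hx hy e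
  · refine .inr (chi_bis_mul_disjoint hn.1 hm.1 (mem_setF.1 hn').1 (mem_setF.1 hm').1
      (isClopen_Z _).compl (isClopen_Z _) fun x hx y hy h1 h2 => ?_)
    exact act_ne_act_of_mem_setE_of_mem_setF hm hn' h1 h2 hx
  · refine .inr (chi_bis_mul_disjoint (mem_setF.1 hn).1 (mem_setF.1 hm).1 hn'.1 hm'.1
      (isClopen_Z _) (isClopen_Z _).compl fun x hx y hy h1 h2 e => ?_)
    exact act_ne_act_of_mem_setE_of_mem_setF hn' hm h2 h1 hy e.symm
  · by_cases h : m = n'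
    · subst h
      have hs := src_of_mem_setE (setF_subset_setE k i hm)
      have hs' := src_of_mem_setE (setF_subset_setE k i hn)
      rw [chi_bis_mul_same (mem_setF.1 hn).1 (mem_setF.1 hm).1 (mem_setF.1 hm').1
        (hs'.trans hs.symm) (isClopen_Z _)]
      exact .inl ⟨_, .inr ⟨m', hm', n, hn, rfl⟩, rfl⟩
    · refine .inr (chi_bis_mul_disjoint (mem_setF.1 hn).1 (mem_setF.1 hm).1 (mem_setF.1 hn').1
        (mem_setF.1 hm').1 (isClopen_Z _) (isClopen_Z _) fun x hx y hy h1 h2 e => h ?_)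
      exact eq_of_act_eq_of_mem_setF hm hn' h1 h2 e

theorem coe_stage (k : ℕ → ℕ) (i : ℕ) :
    (stage k i : Set (CStarG k)) = Submodule.span ℂ (chi k '' genSets k i) :=
  adjoin_eq_span_of_mul_mem chi_mul_mem star_chi_mem

theorem finiteDimensional_stage (k : ℕ → ℕ) (i : ℕ) : FiniteDimensional ℂ (stage k i) := by
  have h : (stage k i).toNonUnitalSubalgebra.toSubmodule = Submodule.span ℂ (chi k '' genSets k i) :=
    SetLike.coe_injective (coe_stage k i)
  have h' : FiniteDimensional ℂ (stage k i).toNonUnitalSubalgebra.toSubmodule := by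
    rw [h]
    exact FiniteDimensional.span_of_finite ℂ ((finite_genSets k i).image _)
  exact h'

/-! ### The inclusions between the stages -/

/-- Otherwise x consists of the vertex alone and is properly contained in the set of prefixes of α.
-/
theorem exists_edge_mem_of_mem_maximals {x : DHSet k} {n : ℕ} (hx : x ∈ maximals k)
    (hn : x.HasRange n) : alpha k n ∈ x.carrier ∨ beta k n ∈ x.carrier ∨
      ∃ j, ∃ hj : j < k n, gamma k n j hj ∈ x.carrier := by
  by_contra! hcon
  obtain ⟨h1, h2, h3⟩ := hcon
  let y : DHSet k :=
    { carrier := {l | l.IsPrefix (alpha k n)}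
      nonempty := ⟨_, IsPrefix.refl _⟩
      directed := fun a ha b hb => ⟨_, IsPrefix.refl _, ha, hb⟩
      hereditary := fun a ha l hl => hl.trans ha }
  have hy : y = x := by
    refine hx y fun l hl => isPrefix_iff.2 ⟨hn l hl, ?_⟩
    have key : ∀ m : Lam k, m.rng = n → Pre m.word l.word → m ∈ x.carrier := fun m hm h =>
      x.hereditary l hl m (isPrefix_iff.2 ⟨hm.trans (hn l hl).symm, h⟩)
    have h4 : ¬ Pre (flat 1 0) l.word := fun h => h1 (key _ rfl h)
    have h5 : ¬ Pre (flat 0 1) l.word := fun h => h2 (key _ rfl h)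
    obtain ⟨r, w, hv⟩ := l
    obtain rfl : r = n := hn _ hl
    cases w with
    | flat p q =>
      simp only [flat_pre_flat, alpha] at *
      omega
    | cut p q j w =>
      simp only [flat_pre_cut] at h4 h5
      obtain rfl : p = 0 := by omega
      obtain rfl : q = 0 := by omega
      refine absurd (key (gamma k r j hv.1) rfl ?_) (h3 j hv.1)
      exact cut_pre_cut.2 ⟨rfl, rfl, rfl, w, (one_mul' w).symm⟩
  exact h1 (hy ▸ IsPrefix.refl (alpha k n))

/-- Only finitely many edges end at each vertex, so the property defines a closed set and passes
from the maximal points to their closure. -/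
theorem exists_edge_mem_of_mem_boundary {x : DHSet k} {n : ℕ} (hx : x ∈ boundary k)
    (hn : x.HasRange n) : alpha k n ∈ x.carrier ∨ beta k n ∈ x.carrier ∨
      ∃ j, ∃ hj : j < k n, gamma k n j hj ∈ x.carrier := by
  have hc : IsClosed ((Z (unit k n))ᶜ ∪ (Z (alpha k n) ∪ (Z (beta k n) ∪
      ⋃ j : Fin (k n), Z (gamma k n j j.2)))) :=
    (isClopen_Z _).compl.isClosed.union ((isClopen_Z _).isClosed.union
      ((isClopen_Z _).isClosed.union (isClosed_iUnion_of_finite fun j => (isClopen_Z _).isClosed)))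
  have hsub := closure_minimal (s := maximals k) (fun y hy => ?_) hc
  · obtain h | h | h | h := hsub hx
    · exact absurd (unit_mem_iff.2 hn) h
    · exact .inl h
    · exact .inr (.inl h)
    · obtain ⟨j, hj⟩ := Set.mem_iUnion.1 h
      exact .inr (.inr ⟨j, j.2, hj⟩)
  · by_cases hyn : y.HasRange n
    · obtain h | h | ⟨j, hj, h⟩ := exists_edge_mem_of_mem_maximals hy hyn
      · exact .inr (.inl h)
      · exact .inr (.inr (.inl h))
      · exact .inr (.inr (.inr (Set.mem_iUnion.2 ⟨⟨j, hj⟩, h⟩)))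
    · exact .inl fun h => hyn (unit_mem_iff.1 h)

theorem chi_mem_stage {i : ℕ} {S : Set (G k)} (h : S ∈ genSets k i) : chi k S ∈ stage k i :=
  NonUnitalStarAlgebra.subset_adjoin ℂ _ ⟨S, h, rfl⟩

theorem comp_mem_setE {i : ℕ} {m e : Lam k} (hm : m ∈ setE k i) (h : m.src = e.rng)
    (he : e.len = 1) : m.comp e h ∈ setE k (i + 1) := by
  refine ⟨hm.1, ?_⟩
  have h1 : m.word.len = i := hm.2
  have h2 : e.word.len = 1 := he
  rw [Lam.len, comp, len_mul, h1, h2]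

/-- Split by whether β occurs: the part without β is a generator of the first kind for p, q, and the
part with β is one of the second kind for pβ, qβ. -/
theorem chi_bis_unit_mem_stage {i : ℕ} {p q : Lam k} (hp : p ∈ setE k i) (hq : q ∈ setE k i)
    (hpb : BetaTail (mul p.word (flat 0 1))) (hqb : BetaTail (mul q.word (flat 0 1))) :
    chi k (G.bis p q (Z (unit k i))) ∈ stage k i := by
  have hp' := src_of_mem_setE hp
  have hq' := src_of_mem_setE hq
  have h1 : G.bis p q (Z (unit k i)) = G.bis p q ((Z (beta k i))ᶜ ∪ Z (beta k i)) :=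
    G.bis_congr hp.1 fun x _ hx => by
      rw [Set.compl_union_self]
      exact ⟨fun _ => trivial, fun _ => unit_mem_iff.2 (hp' ▸ hx)⟩
  rw [h1, G.bis_union, chi_union (G.isCompact_isClopen_bis hp.1 hq.1 (isClopen_Z _).compl)
    (G.isCompact_isClopen_bis hp.1 hq.1 (isClopen_Z _)) (G.disjoint_bis _ _ disjoint_compl_left)]
  refine add_mem (chi_mem_stage (.inl ⟨q, hq, p, hp, rfl⟩)) ?_
  rw [← G.bis_comp_Z_unit (e := beta k i) hp' hq']
  refine chi_mem_stage (.inr ⟨_, mem_setF.2 ?_, _, mem_setF.2 ?_, rfl⟩)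
  · exact ⟨hq.1, (comp_mem_setE hq hq' rfl).2, hqb⟩
  · exact ⟨hp.1, (comp_mem_setE hp hp' rfl).2, hpb⟩

/-- Since αβ = βα, the set αy contains β exactly when y does. -/
theorem mem_Z_alpha_sdiff_Z_beta {n : ℕ} {y : DHSet k} (hy : y.HasRange (alpha k n).src) :
    act (alpha k n) y hy ∈ Z (alpha k n) \ Z (beta k n) ↔ y ∈ (Z (beta k (n + 1)))ᶜ := by
  have h : act (alpha k n) y hy ∈ Z (beta k n) ↔ y ∈ Z (beta k (n + 1)) := by
    constructor
    · rintro ⟨l, hl, hb⟩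
      refine y.hereditary l hl _ (isPrefix_iff.2 ⟨(hy l hl).symm, ?_⟩)
      have hb' : Pre (flat 0 1) (mul (flat 1 0) l.word) := (isPrefix_iff.1 hb).2
      change Pre (flat 0 1) l.word
      cases hw : l.word <;> rw [hw] at hb' <;>
        simp only [mul, flat_pre_flat, flat_pre_cut] at * <;> omega
    · exact fun h => ⟨_, h, isPrefix_iff.2 ⟨rfl, flat_pre_flat.2 (by omega)⟩⟩
  rw [Set.mem_sdiff, Set.mem_compl_iff, h, and_iff_right]
  exact self_mem_act _ _ hy

theorem chi_bis_compl_beta_mem_stage {i : ℕ} {m n : Lam k} (hm : m ∈ setE k i) (hn : n ∈ setE k i) :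
    chi k (G.bis m n (Z (beta k i))ᶜ) ∈ stage k (i + 1) := by
  have hm' := src_of_mem_setE hm
  have hn' := src_of_mem_setE hn
  have hnice : ∀ {A : Set (DHSet k)}, IsClopen A →
      IsCompact (G.bis m n A) ∧ IsClopen (G.bis m n A) :=
    fun hA => G.isCompact_isClopen_bis hm.1 hn.1 hA
  have hpre : ∀ {x : DHSet k} {a b : Lam k}, a ∈ x.carrier → b ∈ x.carrier →
      ∃ w, Pre a.word w ∧ Pre b.word w := fun {x a b} ha hb => by
    obtain ⟨l, -, h1, h2⟩ := x.directed a ha b hb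
    exact ⟨l.word, (isPrefix_iff.1 h1).2, (isPrefix_iff.1 h2).2⟩
  -- A γ starting a path excludes any α or β at the front of that path.
  have hflat : ∀ {x : DHSet k} {a b p q : ℕ} {j : ℕ} {hj : j < k a} {hv}, 0 < p + q →
      (⟨b, flat p q, hv⟩ : Lam k) ∈ x.carrier → gamma k a j hj ∉ x.carrier := by
    intro x a b p q j hj hv hpq h1 h2
    obtain ⟨w, h3, h4⟩ := hpre h1 h2
    cases w <;> simp only [gamma, flat_pre_cut, cut_pre_cut, not_cut_pre_flat] at h3 h4
    omega
  -- On the boundary, a point without β starts with α or with exactly one γ. The α part is the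
  -- first-kind generator for mα, nα, and each γ part falls under `chi_bis_unit_mem_stage`.
  have h1 : G.bis m n (Z (beta k i))ᶜ = G.bis m n ((Z (alpha k i) \ Z (beta k i)) ∪
      ⋃ j ∈ (Finset.univ : Finset (Fin (k i))), Z (gamma k i j j.2)) := by
    refine G.bis_congr hm.1 fun x hx hr => ?_
    rw [hm'] at hr
    constructor
    · intro hb
      obtain h | h | ⟨j, hj, h⟩ := exists_edge_mem_of_mem_boundary hx hr
      · exact .inl ⟨h, hb⟩
      · exact absurd h hb
      · exact .inr (Set.mem_iUnion₂.2 ⟨⟨j, hj⟩, Finset.mem_univ _, h⟩)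
    · rintro (h | h)
      · exact h.2
      · obtain ⟨j, -, h⟩ := Set.mem_iUnion₂.1 h
        exact fun hb => hflat (by omega) hb h
  have hdis : Disjoint (Z (alpha k i) \ Z (beta k i))
      (⋃ j ∈ (Finset.univ : Finset (Fin (k i))), Z (gamma k i j j.2)) := by
    refine Set.disjoint_left.2 fun x hx h => ?_
    obtain ⟨j, -, h⟩ := Set.mem_iUnion₂.1 h
    exact hflat (by omega) hx.1 h
  rw [h1, G.bis_union, chi_union (hnice ((isClopen_Z _).diff (isClopen_Z _)))
    (hnice (isClopen_biUnion_finset fun j _ => isClopen_Z _))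
    (G.disjoint_bis _ _ hdis), G.bis_biUnion]
  refine add_mem ?_ ?_
  · rw [← G.bis_comp (e := alpha k i) hm' hn' (fun y hy => mem_Z_alpha_sdiff_Z_beta hy)
      Set.sdiff_subset]
    exact chi_mem_stage (.inl ⟨_, comp_mem_setE hn hn' rfl, _, comp_mem_setE hm hm' rfl, rfl⟩)
  · refine chi_biUnion_mem _ (fun j => hnice (isClopen_Z _)) (fun j j' hj => ?_)
      (stage k (i + 1)).toNonUnitalSubalgebra.toSubmodule fun j => ?_
    · refine G.disjoint_bis _ _ (Set.disjoint_left.2 fun x h h' => hj ?_)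
      obtain ⟨w, h3, h4⟩ := hpre h h'
      cases w <;> simp only [gamma, cut_pre_cut, not_cut_pre_flat] at h3 h4
      exact Fin.ext (h3.2.2.1.trans h4.2.2.1.symm)
    · have hb : ∀ u : NWord, BetaTail (mul (mul u (cut 0 0 j (flat 0 0))) (flat 0 1)) := fun u =>
        betaTail_mul_flat le_rfl (.inr ⟨u, j, rfl⟩)
      have := chi_bis_unit_mem_stage
        (comp_mem_setE (e := gamma k i j j.2) hm hm' rfl)
        (comp_mem_setE (e := gamma k i j j.2) hn hn' rfl) (hb _) (hb _)
      rw [← G.bis_comp_Z_unit (e := gamma k i j j.2) hm' hn']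
      exact this

theorem monotone_stage (k : ℕ → ℕ) : Monotone (stage k) := by
  refine monotone_nat_of_le_succ fun i => NonUnitalStarAlgebra.adjoin_le ?_
  rintro _ ⟨_, ⟨m, hm, n, hn, rfl⟩ | ⟨m, hm, n, hn, rfl⟩, rfl⟩
  · exact chi_bis_compl_beta_mem_stage hn hm
  · exact chi_bis_unit_mem_stage (setF_subset_setE k i hn) (setF_subset_setE k i hm)
      (mem_setF.1 hn).2.2.mul_beta (mem_setF.1 hm).2.2.mul_beta

theorem coe_subC (k : ℕ → ℕ) :
    (subC k : Set (CStarG k)) = closure (⋃ i, (stage k i : Set (CStarG k))) := by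
  rw [← NonUnitalStarSubalgebra.coe_iSup_of_directed (monotone_stage k).directed_le]
  rfl

/-! ### The point `α^∞ β^∞` -/

/-- The directed hereditary set of all words in `α` and `β`. -/
def flatPoint (k : ℕ → ℕ) (n : ℕ) : DHSet k where
  carrier := {l | l.rng = n ∧ ∃ p q, l.word = flat p q}
  nonempty := ⟨unit k n, rfl, 0, 0, rfl⟩
  directed := by
    rintro a ⟨ha, p, q, hpq⟩ b ⟨hb, p', q', hpq'⟩
    refine ⟨⟨n, flat (max p p') (max q q'), trivial⟩, ⟨rfl, _, _, rfl⟩, isPrefix_iff.2 ⟨ha, ?_⟩,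
      isPrefix_iff.2 ⟨hb, ?_⟩⟩
    · rw [hpq, flat_pre_flat]; omega
    · rw [hpq', flat_pre_flat]; omega
  hereditary := by
    rintro a ⟨ha, p, q, hpq⟩ l hl
    rw [isPrefix_iff, hpq] at hl
    refine ⟨hl.1.trans ha, ?_⟩
    cases hw : l.word with
    | flat p q => exact ⟨p, q, rfl⟩
    | cut p q j w =>
      rw [hw] at hl
      exact absurd hl.2 not_cut_pre_flat

theorem flatPoint_hasRange (k : ℕ → ℕ) (n : ℕ) : (flatPoint k n).HasRange n := fun _ hl => hl.1

/-- A larger directed set would contain some path beginning with α^p β^q γ together with α^{p+1},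
and these have no common extension. -/
theorem flatPoint_mem_maximals (k : ℕ → ℕ) (n : ℕ) : flatPoint k n ∈ maximals k := by
  intro y hy
  refine DHSet.ext (Set.Subset.antisymm (fun l hl => ?_) hy)
  have hr : y.HasRange n := hasRange_of_mem (l := unit k n) (hy ⟨rfl, 0, 0, rfl⟩)
  refine ⟨hr l hl, ?_⟩
  cases hw : l.word with
  | flat p q => exact ⟨p, q, rfl⟩
  | cut p q j w =>
    exfalso
    have h1 : (⟨n, flat (p + 1) 0, trivial⟩ : Lam k) ∈ y.carrier := hy ⟨rfl, _, _, rfl⟩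
    obtain ⟨c, -, h2, h3⟩ := y.directed _ hl _ h1
    rw [isPrefix_iff, hw] at h2
    rw [isPrefix_iff] at h3
    cases hc : c.word <;> rw [hc] at h2 h3
    · exact not_cut_pre_flat h2.2
    · have h4 := cut_pre_cut.1 h2.2
      have h5 := flat_pre_cut.1 h3.2
      omega

/-- Only one inclusion needs checking, since the left side is maximal. -/
theorem act_flatPoint {m : Lam k} {p q : ℕ} (hm : m.word = flat p q)
    (h : (flatPoint k m.src).HasRange m.src) :
    act m (flatPoint k m.src) h = flatPoint k m.rng := by
  refine (((act_mem_maximals h).2 (flatPoint_mem_maximals k _)) _ ?_).symm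
  rintro l ⟨n, ⟨hn, p', q', hn'⟩, hl⟩
  refine (flatPoint k m.rng).hereditary (m.comp n hn.symm) ⟨rfl, p + p', q + q', ?_⟩ l hl
  change mul m.word n.word = _
  rw [hm, hn', mul]

/-! ### The matrix coefficient at `α^∞ β^∞` -/

/-- The matrix coefficient of `C*(G)` that evaluates a function at the elements of the isotropy group
of `α^∞ β^∞` on which the cocycle has the value `1`. -/
noncomputable def flatCoeff (k : ℕ → ℕ) : CStarG k →L[ℂ] ℂ :=
  coeff (flatPoint k 0, 1) (flatPoint k 0, 0)

theorem isCompact_isClopen_twist (k : ℕ → ℕ) : IsCompact (twist k) ∧ IsClopen (twist k) :=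
  G.isCompact_isClopen_bis rfl rfl (isClopen_Z _)

theorem flatCoeff_twist (k : ℕ → ℕ) : flatCoeff k (chi k (twist k)) = 1 := by
  classical
  obtain ⟨f, hf, h⟩ := exists_ofCc_eq_chi (isCompact_isClopen_twist k)
  have h0 : flatPoint k 0 ∈ X k :=
    ⟨subset_closure (flatPoint_mem_maximals k 0), flatPoint_hasRange k 0⟩
  have hr : (flatPoint k 1).HasRange 1 := flatPoint_hasRange k 1
  have e1 : act (alpha k 0) (flatPoint k 1) hr = flatPoint k 0 := act_flatPoint rfl _
  have e2 : act (beta k 0) (flatPoint k 1) hr = flatPoint k 0 := act_flatPoint rfl _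
  let a : G k := ⟨GLam.cls ⟨alpha k 0, beta k 0, flatPoint k 1, hr, hr⟩,
    by rw [GLam.r_cls]; exact e1 ▸ h0, by rw [GLam.s_cls]; exact e2 ▸ h0⟩
  have ha : a ∈ twist k := ⟨_, hr, hr, unit_mem_iff.2 hr, rfl⟩
  -- The cocycle value at a is 1 - 0, one α against none. No other element of the bisection has the
  -- same range, so the sum has one term.
  have ham : a.Moves (flatPoint k 0, 1) (flatPoint k 0, 0) := ⟨e1, e2, rfl⟩
  rw [flatCoeff, h, coeff_ofCc, hf, G.kernel, tsum_eq_single a, if_pos ham,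
    Set.indicator_of_mem ha, Pi.one_apply]
  intro b hb
  by_cases hbt : b ∈ twist k
  · refine if_neg fun hbm => hb ?_
    exact G.bis_injOn _ _ b a (G.mem_bis_of_mem hbt) (G.mem_bis_of_mem ha)
      (.inr (hbm.1.trans ham.1.symm))
  · rw [Set.indicator_of_notMem hbt, ite_self]

theorem flatCoeff_genSets {i : ℕ} {S : Set (G k)} (hS : S ∈ genSets k i) :
    flatCoeff k (chi k S) = 0 := by
  classical
  obtain ⟨f, hf, h⟩ := exists_ofCc_eq_chi (isCompact_isClopen_of_mem_genSets hS)
  have key : ∀ (m : Lam k) (x : DHSet k) (hx : x.HasRange m.src),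
      act m x hx = flatPoint k 0 → m.rng = 0 ∧ ∃ p q, m.word = flat p q := fun m x hx e => by
    have := self_mem_act m x hx
    rwa [e] at this
  rw [flatCoeff, h, coeff_ofCc, hf, G.kernel]
  refine (tsum_congr fun a => ?_).trans tsum_zero
  by_cases ha : a ∈ S
  · refine if_neg ?_
    rintro ⟨h1, h2, h3⟩
    obtain ⟨a, ha'⟩ := a
    obtain ⟨m, hm, n, hn, rfl⟩ | ⟨m, hm, n, hn, rfl⟩ := hS
    · obtain ⟨x, hx1, hx2, hx3, rfl⟩ := ha
      have e : act m x hx2 = flatPoint k 0 := h2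
      obtain ⟨-, p, q, hpq⟩ := key m x hx2 e
      -- The path m is flat, so mβ is flat as well and lies in the point α^∞β^∞ = mx; hence β ∈ x,
      -- which is excluded.
      refine hx3 ((comp_mem_act (m := m) (n := beta k i) (src_of_mem_setE hm) hx2).1 ?_)
      rw [e]
      refine ⟨hm.1, p, q + 1, ?_⟩
      change mul m.word (flat 0 1) = _
      rw [hpq, mul, Nat.add_zero]
    · obtain ⟨x, hx1, hx2, hx3, rfl⟩ := ha
      have hc : (n.word.alphaCount : ℤ) - m.word.alphaCount = 1 := (h3.trans (zero_add _)).symm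
      obtain ⟨-, p, q, hpq⟩ := key m x hx2 h2
      obtain ⟨-, p', q', hpq'⟩ := key n x hx1 h1
      have hbm := (mem_setF.1 hm).2.2
      have hbn := (mem_setF.1 hn).2.2
      rw [hpq] at hbm hc
      rw [hpq'] at hbn hc
      -- A flat word with a β tail contains no α, so the cocycle value would have to be both 0 and
      -- 1.
      simp only [alphaCount, hbm.1, hbn.1] at hc
      omega
  · rw [Set.indicator_of_notMem ha, ite_self]

theorem flatCoeff_eq_zero_of_mem_subC {a : CStarG k} (ha : a ∈ subC k) : flatCoeff k a = 0 := by
  have h1 : (⋃ i, (stage k i : Set (CStarG k))) ⊆ {a | flatCoeff k a = 0} := by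
    refine Set.iUnion_subset fun i b hb => ?_
    rw [coe_stage] at hb
    have h2 : Submodule.span ℂ (chi k '' genSets k i) ≤ (flatCoeff k).toLinearMap.ker := by
      rw [Submodule.span_le]
      rintro _ ⟨S, hS, rfl⟩
      exact flatCoeff_genSets hS
    exact h2 hb
  have h3 : a ∈ closure (⋃ i, (stage k i : Set (CStarG k))) := coe_subC k ▸ ha
  exact closure_minimal h1 (isClosed_eq (flatCoeff k).continuous continuous_const) h3

theorem chi_twist_notMem_subC (k : ℕ → ℕ) : chi k (twist k) ∉ subC k := fun h => by
  have := flatCoeff_eq_zero_of_mem_subC h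
  rw [flatCoeff_twist] at this
  exact one_ne_zero this

theorem one_le_norm_chi_twist_sub {i : ℕ} {S : Set (G k)} (hS : S ∈ genSets k i) :
    1 ≤ ‖chi k (twist k) - chi k S‖ := by
  have h := norm_coeff_le (flatPoint k 0, 1) (flatPoint k 0, 0) (chi k (twist k) - chi k S)
  change ‖flatCoeff k _‖ ≤ _ at h
  rwa [map_sub, flatCoeff_twist, flatCoeff_genSets hS, sub_zero, norm_one] at h

end PathAmalgam

open PathAmalgam in
theorem mainTheorem9 (k : ℕ → ℕ) (hk : {n : ℕ | 0 < k n}.Infinite) :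
    -- all the sets whose characteristic functions occur are compact and clopen subsets of `G`
    (∀ i, ∀ S ∈ genSets k i, IsCompact S ∧ IsClopen S) ∧
    IsCompact (twist k) ∧ IsClopen (twist k) ∧
    -- `C` is the closure of the increasing union of the finite dimensional C*-algebras `C_i`
    (∀ i, (stage k i : Set (CStarG k)) = Submodule.span ℂ (chi k '' genSets k i)) ∧
    (∀ i, FiniteDimensional ℂ (stage k i)) ∧
    Monotone (stage k) ∧
    (subC k : Set (CStarG k)) = closure (⋃ i, (stage k i : Set (CStarG k))) ∧
    -- the characteristic function of `[α, β, Z(v₂)]` is far from all generators and not in `C`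
    (∀ i, ∀ S ∈ genSets k i, 1 ≤ ‖chi k (twist k) - chi k S‖) ∧
    chi k (twist k) ∉ subC k ∧
    subC k ≠ ⊤ := by
  refine ⟨fun i S hS => isCompact_isClopen_of_mem_genSets hS, (isCompact_isClopen_twist k).1,
    (isCompact_isClopen_twist k).2, coe_stage k, finiteDimensional_stage k, monotone_stage k,
    coe_subC k, fun i S hS => one_le_norm_chi_twist_sub hS, chi_twist_notMem_subC k, fun h => ?_⟩
  exact chi_twist_notMem_subC k (h ▸ trivial)
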